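/- Let $n\ge 1$, $k\ge 2$, and let $P=P_n^k$ be the $k$-uniform hyperpath with vertices $0,1,\dots,r=n(k-1)$ and edges $\mathbf e_t=\{(t-1)(k-1),\dots,t(k-1)\}$, $1\le t\le n$, with bank vertex $0$. *Algebra.* For a field $K$ and $\lambda\in K$ put $F_v=\lambda x_v^{k-1}-\sum_{v\in\mathbf e}\prod_{u\in\mathbf e\setminus\{v\}}x_u$, let $f_v$ be $F_v$ with $x_0=1$, and let $A_\lambda=K[x_1,\dots,x_r]/\langle f_1,\dots,f_r\rangle$. A configuration is a map $\mathbf c:\{1,\dots,r\}\to\mathbb N$ (the value at the bank is ignored); $\mathbf x^{\mathbf c}=\prod_v x_v^{\mathbf c(v)}$; $\mathbf c$ is stable if $\mathbf c(v)<k-1$ for all $v\ge 1$. Write $\mathbf c\prec\mathbf c'$ if $\sum_v\mathbf c(v)<\sum_v\mathbf c'(v)$, or these sums are equal and for some $t$ one has $\mathbf c(i)=\mathbf c'(i)$ for $i<t$ and $\mathbf c(t)>\mathbf c'(t)$. *The sets $\mathcal B_s$.* In the dollar game on the complete graph $K_k$ with a bank vertex, a configuration on the non-bank vertices is stable if all its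 values are $<k-1$; a non-bank vertex may be fired (one dollar to each neighbour) if it has at least $k-1$ dollars, the bank may be fired exactly at stable configurations; a stable configuration is critical if some non-empty legal sequence of firings leads back to it. For $0\le s\le n$, $\mathcal B_s$ is the set of stable configurations $\mathbf c$ on $P$ whose restriction to $\mathbf e_i$ (a complete graph with bank $(i-1)(k-1)$) is critical for $1\le i\le s$ and, if $s<n$, is not critical for $i=s+1$. *Firing graph.* For a stable $\mathbf c_0$, the directed graph $\mathcal G(\mathbf c_0)$ consists of everything reachable from $\mathbf c_0$ by the following labelled arrows: from $\mathbf c_0$ there is one arrow $\alpha_{0,\mathbf e_1}$ to $\bar{\mathbf c}_0$, where $\bar{\mathbf c}_0(v)=\mathbf c_0(v)+1$ for $1\le v\le k-1$ and $\bar{\mathbf c}_0(v)=\mathbf c_0(v)$ otherwise; from a non-stable $\mathbf c$, with $u=\max\{v\ge1:\mathbf c(v)\ge k-1\}$, there is for each edge $\mathbf e\ni u$ an arrow $\alpha_{u,\mathbf e}$ to the configuration in which $u$ has lost $k-1$ dollars and every other non-bank vertex of $\mathbf e$ has gained one; there are no other arrows. For $\mathbf c_0\in\mathcal B_s$ let $\mathcal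 G'$ be the set of configurations at the end of a directed path in $\mathcal G(\mathbf c_0)$ from $\mathbf c_0$ that uses an arrow $\alpha_{s(k-1),\mathbf e_{s+1}}$ (empty if $s=n$), and let $\mathcal S(\mathcal G')$ be the finite set of stable configurations in $\mathcal G'$. *Functions $g^i$.* $g^{-1}(x)=0$, $g^0(x)=1$, $g^1(x)=g(x)=\dfrac1{1-x/\lambda^k}$, and $g^i(x)=g^{i-1}(g(x))$ for $i\ge2$. **Lemma.** Let $0\le s\le n$ and $\mathbf c_0\in\mathcal B_s$. Then $\mathbf c_0\prec\mathbf c'$ for every $\mathbf c'\in\mathcal S(\mathcal G')$, and there are rational functions $h_{\mathbf c'}(\lambda)\in\mathbb C(\lambda)$ such that $$\mathbf x^{\bar{\mathbf c}_0}=\frac{g^{s-1}(1)}{\lambda^{k-1}}\,\mathbf x^{\mathbf c_0}+\sum_{\mathbf c'\in\mathcal S(\mathcal G')}h_{\mathbf c'}(\lambda)\,\mathbf x^{\mathbf c'},$$ and hence multiplication by $f_0$ has the triangular form $$f_0\,\mathbf x^{\mathbf c_0}=\Bigl(\lambda-\frac{g^{s-1}(1)}{\lambda^{k-1}}\Bigr)\mathbf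 x^{\mathbf c_0}-\sum_{\mathbf c'\in\mathcal S(\mathcal G')}h_{\mathbf c'}(\lambda)\,\mathbf x^{\mathbf c'}.$$ Both identities hold in $A_\lambda$ over $K=\mathbb C(\lambda)$ with $\lambda$ the indeterminate, and, with the same functions $h_{\mathbf c'}$ evaluated at $\lambda$, in $A_\lambda$ over $K=\mathbb C$ for all but finitely many $\lambda\in\mathbb C$. -/

import Mathlib

/-! Dollar games, firing graphs and the quotient algebra of a hyperpath. -/

namespace Hyperpath

noncomputable section

/-- Configurations (piles of dollars) on a vertex set `V` with bank vertex `w`.  The pile of the bank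
vertex plays no role in stability, in the firing rules or in the monomial of a configuration (and in
the game on a graph it is determined by the other piles, the total being constant), so it is
omitted. -/
abbrev Config {V : Type*} (w : V) := {v : V // v ≠ w} → ℕ

/-! ### Dollar game on a simple graph -/

section Graph

variable {V : Type*} [Fintype V] [DecidableEq V] (G : SimpleGraph V) [DecidableRel G.Adj] (w : V)

/-- Stable: every vertex other than the bank holds fewer dollars than its degree. -/
def GraphStable (c : Config w) : Prop := ∀ v, c v < G.degree v.1

/-- The configuration after firing `x`: one dollar moves along each edge incident to `x`. -/
def graphFire (c : Config w) (x : V) : Config w := fun u =>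
  if u.1 = x then c u - G.degree x else if G.Adj x u.1 then c u + 1 else c u

/-- One `w`-legal firing: a vertex `v ≠ w` needs at least `deg v` dollars, the bank `w` may be
fired only at a stable configuration. -/
def GraphStep (c c' : Config w) : Prop :=
  (∃ v : {v : V // v ≠ w}, G.degree v.1 ≤ c v ∧ c' = graphFire G w c v.1) ∨
    (GraphStable G w c ∧ c' = graphFire G w c w)

/-- Recurrent: some non-empty `w`-legal sequence of firings leads back to the configuration. -/
def GraphRecurrent (c : Config w) : Prop := Relation.TransGen (GraphStep G w) c c

/-- Critical: stable and recurrent. -/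
def GraphCritical (c : Config w) : Prop := GraphStable G w c ∧ GraphRecurrent G w c

end Graph

/-! ### Firing graph of a `k`-uniform hypergraph with vertex set `V` and edge set `E` -/

section Hypergraph

variable {V : Type*} [LinearOrder V] (E : Finset (Finset V)) (k : ℕ) (w : V)

/-- Stable configurations on a `k`-uniform hypergraph. -/
def Stable {V : Type*} (k : ℕ) {w : V} (c : Config w) : Prop := ∀ v, c v < k - 1

/-- Firing the bank on the edge `e`: every other vertex of `e` gains one dollar. -/
def bankFire {V : Type*} [DecidableEq V] {w : V} (c : Config w) (e : Finset V) : Config w :=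
  fun u => if u.1 ∈ e then c u + 1 else c u

/-- Firing `v` on the edge `e`: `v` loses `k - 1` dollars, every other vertex of `e` gains one. -/
def fireOn {V : Type*} [DecidableEq V] (k : ℕ) {w : V} (c : Config w) (v : {v : V // v ≠ w})
    (e : Finset V) : Config w :=
  fun u => if u = v then c u - (k - 1) else if u.1 ∈ e then c u + 1 else c u

/-- `Arrow E k w c₀ c v e c'`: the arrow `c → c'` labelled `α_{v,e}` of the firing graph of `c₀`.
From `c₀` the bank is fired on an edge containing it; from a non-stable configuration the largest
vertex `v ≠ w` with at least `k - 1` dollars is fired on any edge containing it; there are no other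
arrows. -/
def Arrow (c₀ : Config w) (c : Config w) (v : V) (e : Finset V) (c' : Config w) : Prop :=
  e ∈ E ∧ v ∈ e ∧
    ((c = c₀ ∧ v = w ∧ c' = bankFire c e) ∨
      ∃ hv : v ≠ w, IsGreatest {u : {u : V // u ≠ w} | k - 1 ≤ c u} ⟨v, hv⟩ ∧
        c' = fireOn k c ⟨v, hv⟩ e)

/-- `c'` is the end of a (possibly empty) directed path starting at `c`. -/
def Reach (c₀ : Config w) : Config w → Config w → Prop :=
  Relation.ReflTransGen fun c c' => ∃ v e, Arrow E k w c₀ c v e c'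

/-- The vertices of the firing graph of `c₀`. -/
def firingVertices (c₀ : Config w) : Set (Config w) := {c | Reach E k w c₀ c₀ c}

/-- The configurations of the firing graph of `c₀` obtained by first firing `v` on `e`: those at the
end of a directed path from `c₀` that uses an arrow labelled `α_{v,e}`. -/
def obtainedByFiring (c₀ : Config w) (v : V) (e : Finset V) : Set (Config w) :=
  {c' | ∃ c ∈ firingVertices E k w c₀, ∃ d, Arrow E k w c₀ c v e d ∧ Reach E k w c₀ d c'}

/-- The weight: total number of dollars outside the bank. -/
def weight {V : Type*} [Fintype V] [DecidableEq V] {w : V} (c : Config w) : ℕ := ∑ v, c v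

/-- The left anti-lexicographical order `c ≺ c'`. -/
def Prec {V : Type*} [Fintype V] [LinearOrder V] {w : V} (c c' : Config w) : Prop :=
  weight c < weight c' ∨
    (weight c = weight c' ∧ ∃ t, (∀ i < t, c i = c' i) ∧ c' t < c t)

/-- There are finitely many stable configurations. -/
theorem finite_stable {V : Type*} [Finite V] (k : ℕ) (w : V) :
    {c : Config w | Stable k c}.Finite :=
  Set.Finite.pi' fun _ => Set.finite_lt_nat (k - 1)

end Hypergraph

/-! ### The polynomials `F_v`, `f_v` and the quotient algebra -/

section Algebra

variable {V : Type*} [DecidableEq V] (E : Finset (Finset V)) (k : ℕ) (w : V)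
  {K : Type*} [Field K] (lam : K)

open MvPolynomial

/-- `F_v = λ x_v^{k-1} - ∑_{v ∈ e ∈ E} ∏_{u ∈ e ∖ {v}} x_u`. -/
def bigF (v : V) : MvPolynomial V K :=
  C lam * X v ^ (k - 1) - ∑ e ∈ E with v ∈ e, ∏ u ∈ e.erase v, X u

/-- `f_v`: the polynomial `F_v` with `x_w = 1`. -/
def smallF (v : V) : MvPolynomial {u : V // u ≠ w} K :=
  aeval (fun u : V => if h : u = w then 1 else X ⟨u, h⟩) (bigF E k lam v)

/-- The ideal `⟨f_v : v ≠ w⟩`. -/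
def pIdeal : Ideal (MvPolynomial {u : V // u ≠ w} K) :=
  Ideal.span (Set.range fun v : {u : V // u ≠ w} => smallF E k w lam v.1)

/-- The quotient algebra `A = K[x_v : v ≠ w] / ⟨f_v : v ≠ w⟩`. -/
abbrev QuotAlg := MvPolynomial {u : V // u ≠ w} K ⧸ pIdeal E k w lam

/-- The class in `A` of the monomial `x^c`. -/
def mono [Fintype V] (c : Config w) : QuotAlg E k w lam :=
  Ideal.Quotient.mk (pIdeal E k w lam) (∏ v, X v ^ c v)

/-- The class of `f_w` in `A`. -/
def bankF : QuotAlg E k w lam := Ideal.Quotient.mk (pIdeal E k w lam) (smallF E k w lam w)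

end Algebra

/-! ### The hyperpath with `n` edges -/

/-- The vertices `0, 1, …, n(k-1)` of the hyperpath; `0` is the bank. -/
abbrev PathVertex (n k : ℕ) := Fin (n * (k - 1) + 1)

/-- The edge `e_t = {(t-1)(k-1), …, t(k-1)}`, for `1 ≤ t ≤ n`. -/
def pathEdge (n k t : ℕ) : Finset (PathVertex n k) :=
  Finset.univ.filter fun v => (t - 1) * (k - 1) ≤ v.1 ∧ v.1 ≤ t * (k - 1)

/-- The edge set `{e_1, …, e_n}`. -/
def pathEdges (n k : ℕ) : Finset (Finset (PathVertex n k)) :=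
  (Finset.Icc 1 n).image (pathEdge n k)

/-- Configurations on the hyperpath with bank vertex `0`. -/
abbrev PathConfig (n k : ℕ) := Config (0 : PathVertex n k)

theorem block_lt {n k : ℕ} (i : Fin n) (j : Fin (k - 1 + 1)) :
    i.1 * (k - 1) + j.1 < n * (k - 1) + 1 := by
  have h := Nat.mul_le_mul_right (k - 1) (Nat.succ_le_of_lt i.2)
  have hj := j.2
  rw [Nat.succ_mul] at h
  omega

theorem block_ne {n k : ℕ} (i : Fin n) (j : {j : Fin (k - 1 + 1) // j ≠ 0}) :
    (⟨i.1 * (k - 1) + j.1.1, block_lt i j.1⟩ : PathVertex n k) ≠ 0 := by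
  intro h
  have h1 : i.1 * (k - 1) + j.1.1 = 0 := congrArg Fin.val h
  have h2 : j.1.1 = 0 := by omega
  exact j.2 (Fin.ext h2)

/-- The restriction of `c` to the edge with vertices `i(k-1), …, (i+1)(k-1)` (edges are counted from
`0` here), as a configuration on the complete graph with vertices `0, …, k-1` whose bank is the
first vertex of the edge. -/
def block {n k : ℕ} (c : PathConfig n k) (i : Fin n) : Config (0 : Fin (k - 1 + 1)) :=
  fun j => c ⟨⟨i.1 * (k - 1) + j.1.1, block_lt i j.1⟩, block_ne i j⟩

/-- `𝓑_s`: the stable configurations whose restrictions to the first `s` edges are critical on the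
complete graph, while the restriction to the next edge, if there is one, is not. -/
def pathB (n k s : ℕ) : Set (PathConfig n k) :=
  {c | Stable k c ∧ (∀ i : Fin n, i.1 < s → GraphCritical ⊤ 0 (block c i)) ∧
    ∀ i : Fin n, i.1 = s → ¬ GraphCritical ⊤ 0 (block c i)}

/-- The vertex set of `𝒢'`: the configurations of the firing graph of `c₀` obtained by first firing
the vertex `s(k-1)` on the edge `e_{s+1}`; there are none if `s ≥ n`. -/
def pathG' (n k s : ℕ) (c₀ : PathConfig n k) : Set (PathConfig n k) :=
  {c' | s < n ∧ c' ∈ obtainedByFiring (pathEdges n k) k 0 c₀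
    (Fin.ofNat (n * (k - 1) + 1) (s * (k - 1))) (pathEdge n k (s + 1))}

theorem finite_stable_pathG' (n k s : ℕ) (c₀ : PathConfig n k) :
    {c' | c' ∈ pathG' n k s c₀ ∧ Stable k c'}.Finite :=
  (finite_stable k (0 : PathVertex n k)).subset fun _ h => h.2

/-- `𝒮(𝒢')`: the stable configurations in `𝒢'`. -/
def stableG' (n k s : ℕ) (c₀ : PathConfig n k) : Finset (PathConfig n k) :=
  (finite_stable_pathG' n k s c₀).toFinset

/-- The quotient algebra of the hyperpath with parameter `λ` in the field `K`. -/
abbrev PathAlg (n k : ℕ) {K : Type} [Field K] (lam : K) :=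
  QuotAlg (pathEdges n k) k (0 : PathVertex n k) lam

/-- The class of `x^c` in the quotient algebra of the hyperpath. -/
abbrev pathMono {n k : ℕ} {K : Type} [Field K] (lam : K) (c : PathConfig n k) :
    PathAlg n k lam := mono (pathEdges n k) k 0 lam c

/-- The class of `f_0` in the quotient algebra of the hyperpath. -/
abbrev pathF0 (n k : ℕ) {K : Type} [Field K] (lam : K) : PathAlg n k lam :=
  bankF (pathEdges n k) k 0 lam

/-- The functions `g^i` for `i ≥ 0`: `g^0(x) = 1`, `g^1(x) = g(x) = 1 / (1 - x / λ^k)` and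
`g^i(x) = g^{i-1}(g(x))` for `i ≥ 2`. -/
def gNat {K : Type} [Field K] (k : ℕ) (lam : K) : ℕ → K → K
  | 0, _ => 1
  | 1, x => 1 / (1 - x / lam ^ k)
  | i + 2, x => gNat k lam (i + 1) (1 / (1 - x / lam ^ k))

/-- The functions `g^i` for `i ≥ -1`, where `g^{-1}(x) = 0`. -/
def gFun {K : Type} [Field K] (k : ℕ) (lam : K) (i : ℤ) (x : K) : K :=
  if i < 0 then 0 else gNat k lam i.toNat x

end

end Hyperpath

open Hyperpath

/-! Each relation `f_v = 0` with `v ≠ 0` is a firing rule: if `v` holds at least `k - 1` dollars,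
then `lam • x^c` is the sum of the monomials obtained by firing `v` on the edges through it
(`smul_mono`). The lemma thus becomes a statement about the dollar game.

Diagonal coefficient (`pathMono_fire_sub_mem`, by induction on the number `r` of critical edges
still ahead). By Dhar's burning criterion, once the first vertex of a critical edge has fired on
that edge, the other vertices can each fire on it exactly once, in the order imposed by the firing
graph, and the configuration is then restored. Each firing contributes a factor `lam⁻¹`, except at
the joint with the next edge. There a second branch fires into the next edge, and by induction it
returns `tailCoeff r / lam^(k-1)` times the same monomial. So at the joint `lam` is replaced by `lam
- tailCoeff r / lam^(k-1)`, which is the recursion defining `g^i(1)`. The branch that enters the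
edge after the first `s` ones lands in `𝒢'`.

Reduction inside `𝒢'`. This set is finite and closed under firing, but directed cycles are not
excluded, so termination is not available. Instead, modulo the stable monomials of `𝒢'`, all its
monomials span a finite-dimensional `ℂ`-space that is stable under multiplication by the
transcendental `lam`, and such a space is zero (`eq_zero_of_smul_mem_span`, `mono_mem_span_stable`).

Order (`prec_of_mem_pathG'`). On each edge no vertex fires more often than the first one, so the net
flow of dollars into the edge through its first vertex is nonnegative. A non-critical edge contains
a forbidden set, whose vertices always lag behind the first vertex, so the flow into the edge after
the first `s` ones is positive. The first positive flow either increases the total weight or lowers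
a joint whose predecessors are all unchanged.

Specialization (`eventually_mono_eq`). Ideal membership over `ℂ(λ)` is transported to complex `λ`
through germs along the cofinite filter. -/

namespace Hyperpath

/-! ### Critical configurations on a complete graph: Dhar's burning criterion. -/

section Complete

open Finset

variable {V : Type*} [Fintype V] [DecidableEq V] {w : V}

/-- The arithmetic of a legal firing: if `v` fires, then it has fired fewer times than the bank. -/
theorem count_lt_of_fire {ι : Type*} {s : Finset ι} {a : ι → ℤ} {B c₀ c : ℤ} {i : ι}
    (ha : ∀ j ∈ s, a j ≤ B) (hi : i ∈ s) (h₀ : c₀ < s.card)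
    (hc : c + (s.card + 1) * a i ≤ c₀ + B + ∑ j ∈ s, a j) (hfire : s.card ≤ c) :
    a i + 1 ≤ B := by
  by_contra hlt
  have hB : a i = B := le_antisymm (ha i hi) (by omega)
  have hsum : ∑ j ∈ s, a j ≤ s.card * B := by
    have := Finset.sum_le_card_nsmul s a B ha
    simpa using this
  rw [hB] at hc
  linarith

/-- The arithmetic of a legal firing of a vertex of a set `F` all of whose vertices hold fewer than
`|F| - 1` dollars. -/
theorem count_lt_of_fire_of_forbidden {ι : Type*} [DecidableEq ι] {s F : Finset ι} {a : ι → ℤ}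
    {B c₀ c : ℤ} {i : ι} (hF : F ⊆ s) (ha : ∀ j ∈ s, a j ≤ B) (haF : ∀ j ∈ F, a j + 1 ≤ B)
    (hi : i ∈ F) (h₀ : c₀ + 1 < F.card)
    (hc : c + (s.card + 1) * a i ≤ c₀ + B + ∑ j ∈ s, a j) (hfire : s.card ≤ c) :
    a i + 2 ≤ B := by
  by_contra hlt
  have hB : a i = B - 1 := by have := haF i hi; omega
  have hsum : ∑ j ∈ s, a j ≤ s.card * B - F.card := by
    have h1 : ∑ j ∈ s, a j ≤ ∑ j ∈ s, (B - if j ∈ F then 1 else 0) := by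
      refine Finset.sum_le_sum fun j hj => ?_
      split_ifs with hjF
      · have := haF j hjF; omega
      · have := ha j hj; omega
    rw [Finset.sum_sub_distrib, Finset.sum_ite_mem, Finset.inter_eq_right.2 hF] at h1
    simpa using h1
  rw [hB] at hc
  linarith

/-- Every non-empty set `F` of vertices other than the bank contains a vertex holding at least
`|F| - 1` dollars. -/
def NoForbidden {ι : Type*} (s : Finset ι) (f : ι → ℕ) : Prop :=
  ∀ F ⊆ s, F.Nonempty → ∃ i ∈ F, F.card ≤ f i + 1

theorem degree_complete (v : V) : (⊤ : SimpleGraph V).degree v = Fintype.card V - 1 := by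
  rw [← SimpleGraph.complete_graph_degree v]

theorem card_nonbank : Fintype.card {v : V // v ≠ w} = Fintype.card V - 1 := by
  simp [Fintype.card_subtype_compl]

/-- Here `U` is the set of vertices already fired after the bank. Since the complement of `U` is not
forbidden, it contains a vertex with enough dollars to fire next; when `U` is everything, the gains
and losses cancel. The hypothesis `hU` keeps the natural-number subtraction from truncating. -/
theorem transGen_complete_of_noForbidden {c : Config w}
    (h : NoForbidden (univ : Finset {v : V // v ≠ w}) c) (U : Finset {v : V // v ≠ w})
    (hU : ∀ u ∈ U, Fintype.card V ≤ c u + 1 + U.card) :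
    Relation.ReflTransGen (GraphStep ⊤ w)
      (fun u => c u + 1 + U.card - if u ∈ U then Fintype.card V else 0) c := by
  have hcard : 0 < Fintype.card V := Fintype.card_pos_iff.2 ⟨w⟩
  induction hn : Uᶜ.card generalizing U with
  | zero =>
    have hU' : U = univ := by simpa using hn
    subst hU'
    have : (fun u => c u + 1 + (univ : Finset {v : V // v ≠ w}).card -
        if u ∈ (univ : Finset {v : V // v ≠ w}) then Fintype.card V else 0) = c := by
      funext u
      simp only [mem_univ, if_true, card_univ, card_nonbank]
      omega
    rw [this]
  | succ n ih =>
    obtain ⟨v, hv, hvc⟩ := h Uᶜ (subset_univ _) (card_pos.1 (by omega))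
    have hvU : v ∉ U := by simpa using hv
    have hcc : Uᶜ.card + U.card = Fintype.card V - 1 := by
      rw [add_comm, card_add_card_compl, card_nonbank]
    have hins : (insert v U).card = U.card + 1 := card_insert_of_notMem hvU
    refine Relation.ReflTransGen.head (Or.inl ⟨v, ?_, rfl⟩) ?_
    · simp only [degree_complete, if_neg hvU]; omega
    · have hstep : graphFire ⊤ w
          (fun u => c u + 1 + U.card - if u ∈ U then Fintype.card V else 0) v.1 =
          fun u => c u + 1 + (insert v U).card -
            if u ∈ insert v U then Fintype.card V else 0 := by
        funext u
        simp only [graphFire, degree_complete, hins, mem_insert, SimpleGraph.top_adj]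
        by_cases huv : u = v
        · subst huv; simp [hvU]; omega
        · have h1 : u.1 ≠ v.1 := fun e => huv (Subtype.ext e)
          by_cases huU : u ∈ U
          · have := hU u huU
            simp [huv, h1, huU, h1.symm]; omega
          · simp [huv, h1, huU, h1.symm]; omega
      rw [hstep]
      refine ih _ ?_ ?_
      · intro u hu
        rw [hins]
        rcases mem_insert.1 hu with rfl | hu
        · omega
        · have := hU u hu; omega
      · rw [card_compl, hins]
        rw [card_compl] at hn
        omega

theorem graphCritical_complete_of_noForbidden {c : Config w}
    (hc : ∀ v, c v < Fintype.card V - 1)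
    (h : NoForbidden (univ : Finset {v : V // v ≠ w}) c) : GraphCritical ⊤ w c := by
  have hst : GraphStable ⊤ w c := fun v => by rw [degree_complete]; exact hc v
  refine ⟨hst, Relation.TransGen.head' (Or.inr ⟨hst, rfl⟩) ?_⟩
  have := transGen_complete_of_noForbidden h ∅ (by simp)
  convert this using 1
  funext u
  simp [graphFire, u.2, u.2.symm]

/-- The numbers `a v` and `B` of firings of the vertices `v` and of the bank in a legal sequence
from `c₀` to `c`. -/
structure FiringCount (F : Finset {v : V // v ≠ w}) (c₀ c : Config w)
    (a : {v : V // v ≠ w} → ℤ) (B : ℤ) : Prop where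
  eq : ∀ v, (c v : ℤ) + Fintype.card V * a v = c₀ v + B + ∑ u, a u
  le : ∀ v, a v ≤ B
  lt : ∀ v ∈ F, 1 ≤ B → a v + 1 ≤ B

/-- By `count_lt_of_fire` a vertex fires only if it is behind the bank, so after any step the bank
has fired. A vertex of the forbidden set `F` must even be two firings behind, so the strict
inequality survives its own firing; a firing of the bank only widens the gaps. -/
theorem FiringCount.step {F : Finset {v : V // v ≠ w}} {c₀ c c' : Config w}
    {a : {v : V // v ≠ w} → ℤ} {B : ℤ} (h : FiringCount F c₀ c a B)
    (h₀ : ∀ v, c₀ v < Fintype.card V - 1) (hF : ∀ v ∈ F, c₀ v + 1 < F.card)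
    (ha : 0 ≤ a) (hs : GraphStep ⊤ w c c') :
    ∃ a' B', FiringCount F c₀ c' a' B' ∧ 0 ≤ a' ∧ 1 ≤ B' := by
  have hcard : 0 < Fintype.card V := Fintype.card_pos_iff.2 ⟨w⟩
  have hcu : (((univ : Finset {v : V // v ≠ w}).card : ℕ) : ℤ) + 1 = Fintype.card V := by
    rw [card_univ, card_nonbank]; omega
  rcases hs with ⟨v, hv, rfl⟩ | ⟨hst, rfl⟩
  · rw [degree_complete] at hv
    have h1 : a v + 1 ≤ B := by
      refine count_lt_of_fire (s := univ) (c₀ := c₀ v) (c := c v) (fun j _ => h.le j)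
        (mem_univ v) ?_ ?_ ?_
      · have := h₀ v; omega
      · rw [hcu]; exact (h.eq v).le
      · omega
    have hB : 1 ≤ B := by have := ha v; simp at this; omega
    refine ⟨fun u => a u + if u = v then 1 else 0, B, ⟨?_, ?_, ?_⟩, ?_, hB⟩
    · intro u
      have := h.eq u
      simp only [sum_add_distrib, sum_ite_eq', mem_univ, if_true, graphFire, degree_complete,
        SimpleGraph.top_adj]
      by_cases huv : u = v
      · subst huv
        simp only [if_true, mul_add]
        push_cast [Nat.cast_sub hv, Nat.cast_sub (Nat.succ_le_of_lt hcard)]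
        linarith
      · have h1 : u.1 ≠ v.1 := fun e => huv (Subtype.ext e)
        simp only [h1, huv, h1.symm, if_false, ne_eq, not_false_eq_true, if_true, Nat.cast_add,
          Nat.cast_one, add_zero]
        linarith
    · intro u
      by_cases huv : u = v
      · subst huv; simpa using h1
      · simpa [huv] using h.le u
    · intro u hu _
      by_cases huv : u = v
      · subst huv
        have : a u + 2 ≤ B := by
          refine count_lt_of_fire_of_forbidden (s := univ) (c₀ := c₀ u) (c := c u)
            (subset_univ F) (fun j _ => h.le j) (fun j hj => h.lt j hj hB) hu ?_ ?_ ?_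
          · have := hF u hu; omega
          · rw [hcu]; exact (h.eq u).le
          · omega
        simp only [if_true]; omega
      · simpa [huv] using h.lt u hu hB
    · intro u
      have := ha u
      simp only [Pi.zero_apply] at this ⊢
      split_ifs <;> omega
  -- Without non-bank vertices the conditions on `B` are vacuous and do not give `0 ≤ B`, so the
  -- count 1 is chosen outright.
  · rcases isEmpty_or_nonempty {v : V // v ≠ w} with hV | ⟨⟨v₀⟩⟩
    · exact ⟨a, 1, ⟨fun v => hV.elim v, fun v => hV.elim v, fun v => hV.elim v⟩, ha, le_rfl⟩
    have hB : 0 ≤ B := (ha v₀).trans (h.le v₀)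
    refine ⟨a, B + 1, ⟨?_, ?_, ?_⟩, ha, by omega⟩
    · intro u
      have := h.eq u
      simp only [graphFire, u.2, u.2.symm, if_false, SimpleGraph.top_adj, ne_eq,
        not_false_eq_true, if_true, Nat.cast_add, Nat.cast_one]
      linarith
    · intro u
      have := h.le u
      omega
    · intro u _ _
      have := h.le u
      omega

/-- Returning to `c` forces all firing numbers to agree with that of the bank, whereas the vertices
of a forbidden set have fired strictly less often. -/
theorem noForbidden_of_graphCritical_complete {c : Config w} (h : GraphCritical ⊤ w c) :
    NoForbidden (univ : Finset {v : V // v ≠ w}) c := by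
  obtain ⟨hst, hrec⟩ := h
  have hc : ∀ v, c v < Fintype.card V - 1 := fun v => by
    have := hst v; rwa [degree_complete] at this
  intro F _ hne
  by_contra! hF
  have key : ∃ a B, FiringCount F c c a B ∧ 0 ≤ a ∧ 1 ≤ B := by
    have h0 : FiringCount F c c 0 0 := ⟨by simp, by simp, by simp⟩
    have : ∀ c', Relation.TransGen (GraphStep ⊤ w) c c' →
        ∃ a B, FiringCount F c c' a B ∧ 0 ≤ a ∧ 1 ≤ B := by
      intro c' hc'
      induction hc' with
      | single h1 => exact h0.step hc hF le_rfl h1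
      | tail _ h1 ih =>
        obtain ⟨a, B, hab, ha, -⟩ := ih
        exact hab.step hc hF ha h1
    exact this c hrec
  obtain ⟨a, B, hab, ha, hB⟩ := key
  obtain ⟨v, hv⟩ := hne
  have hcard : 0 < Fintype.card V := Fintype.card_pos_iff.2 ⟨w⟩
  have heq : ∀ u, a u = a v := fun u => by
    have h1 := hab.eq u
    have h2 := hab.eq v
    have h3 : (Fintype.card V : ℤ) * a u = Fintype.card V * a v := by linarith
    exact mul_left_cancel₀ (by exact_mod_cast hcard.ne') h3
  have hcu : (((univ : Finset {v : V // v ≠ w}).card : ℕ) : ℤ) + 1 = Fintype.card V := by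
    rw [card_univ, card_nonbank]; omega
  have hs : ∑ u, a u = (Fintype.card V - 1) * a v := by
    rw [sum_congr rfl fun u _ => heq u, sum_const, nsmul_eq_mul]
    rw [← hcu]; ring
  have h1 := hab.eq v
  have h2 := hab.lt v hv hB
  rw [hs] at h1
  linarith

end Complete

end Hyperpath

namespace Hyperpath

/-! ### Firing counts on the hyperpath and the order `c₀ ≺ c'`. -/

section Path

open Finset

variable {n k : ℕ}

/-! ### Coordinates on the hyperpath -/

/-- The number of dollars at the vertex with number `u`. -/
def val (c : PathConfig n k) (u : ℕ) : ℕ :=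
  if h : u < n * (k - 1) + 1 ∧ u ≠ 0 then
    c ⟨⟨u, h.1⟩, fun e => h.2 (congrArg Fin.val e)⟩ else 0

theorem val_of_lt (c : PathConfig n k) {u : ℕ} (h : u < n * (k - 1) + 1) (h0 : u ≠ 0) :
    val c u = c ⟨⟨u, h⟩, fun e => h0 (congrArg Fin.val e)⟩ := dif_pos ⟨h, h0⟩

theorem ne_zero_val (u : {u : PathVertex n k // u ≠ 0}) : u.1.1 ≠ 0 :=
  fun e => u.2 (Fin.ext e)

@[simp]
theorem val_coe (c : PathConfig n k) (u : {u : PathVertex n k // u ≠ 0}) :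
    val c u.1.1 = c u := val_of_lt c u.1.2 (ne_zero_val u)

theorem config_ext {c d : PathConfig n k} (h : ∀ u, u < n * (k - 1) + 1 → u ≠ 0 →
    val c u = val d u) : c = d := by
  funext u
  rw [← val_coe c u, ← val_coe d u]
  exact h _ u.1.2 (ne_zero_val u)

theorem mem_pathEdge {t : ℕ} {v : PathVertex n k} :
    v ∈ pathEdge n k (t + 1) ↔ t * (k - 1) ≤ v.1 ∧ v.1 ≤ (t + 1) * (k - 1) := by
  simp [pathEdge]

theorem val_bankFire [DecidableEq (PathVertex n k)] (c : PathConfig n k) (t : ℕ) {u : ℕ}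
    (h : u < n * (k - 1) + 1) (h0 : u ≠ 0) :
    val (bankFire c (pathEdge n k (t + 1))) u =
      if t * (k - 1) ≤ u ∧ u ≤ (t + 1) * (k - 1) then val c u + 1 else val c u := by
  simp only [val_of_lt _ h h0, bankFire, mem_pathEdge]

theorem val_fireOn [DecidableEq (PathVertex n k)] (c : PathConfig n k)
    (v : {u : PathVertex n k // u ≠ 0}) (t : ℕ) {u : ℕ}
    (h : u < n * (k - 1) + 1) (h0 : u ≠ 0) :
    val (fireOn k c v (pathEdge n k (t + 1))) u =
      if u = v.1.1 then val c u - (k - 1) else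
      if t * (k - 1) ≤ u ∧ u ≤ (t + 1) * (k - 1) then val c u + 1 else val c u := by
  simp only [val_of_lt _ h h0, fireOn, mem_pathEdge, Subtype.ext_iff, Fin.ext_iff]

theorem pos_lt {m t j : ℕ} (ht : t < n) (hj : j < m) : t * m + j + 1 < n * m + 1 := by
  have := Nat.mul_le_mul_right m (Nat.succ_le_of_lt ht)
  rw [Nat.succ_mul] at this
  omega

theorem pos_inj {m t j t' j' : ℕ} (hj : j < m) (hj' : j' < m) :
    t' * m + j' + 1 = t * m + j + 1 ↔ t' = t ∧ j' = j := by
  constructor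
  · intro h
    rcases lt_trichotomy t t' with h1 | h1 | h1
    · have := Nat.mul_le_mul_right m (Nat.succ_le_of_lt h1)
      rw [Nat.succ_mul] at this
      omega
    · subst h1; omega
    · have := Nat.mul_le_mul_right m (Nat.succ_le_of_lt h1)
      rw [Nat.succ_mul] at this
      omega
  · rintro ⟨rfl, rfl⟩; rfl

theorem pos_mem {m t t' j' : ℕ} (hj' : j' < m) :
    (t * m ≤ t' * m + j' + 1 ∧ t' * m + j' + 1 ≤ (t + 1) * m) ↔
      t' = t ∨ (t' + 1 = t ∧ j' + 1 = m) := by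
  rw [Nat.succ_mul]
  constructor
  · intro h
    rcases lt_trichotomy t t' with h1 | h1 | h1
    · have := Nat.mul_le_mul_right m (Nat.succ_le_of_lt h1)
      rw [Nat.succ_mul] at this
      omega
    · omega
    · right
      rcases Nat.lt_or_ge (t' + 1) t with h2 | h2
      · have := Nat.mul_le_mul_right m (Nat.succ_le_of_lt h2)
        rw [Nat.succ_mul, Nat.succ_mul] at this
        omega
      · have h3 : t' + 1 = t := by omega
        subst h3
        rw [Nat.succ_mul] at h
        omega
  · rintro (rfl | ⟨rfl, h⟩)
    · omega
    · rw [Nat.succ_mul]; omega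

theorem pos_eq_joint {m t t' j' : ℕ} (hj' : j' < m) :
    t' * m + j' + 1 = t * m ↔ t' + 1 = t ∧ j' + 1 = m := by
  constructor
  · intro h
    rcases Nat.lt_or_ge t' t with h1 | h1
    · rcases Nat.lt_or_ge (t' + 1) t with h2 | h2
      · have := Nat.mul_le_mul_right m (Nat.succ_le_of_lt h2)
        rw [Nat.succ_mul, Nat.succ_mul] at this
        omega
      · have h3 : t' + 1 = t := by omega
        subst h3
        rw [Nat.succ_mul] at h
        omega
    · have := Nat.mul_le_mul_right m h1
      omega
  · rintro ⟨rfl, h⟩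
    rw [Nat.succ_mul]; omega

theorem exists_pos {m u : ℕ} (h : u < n * m + 1) (h0 : u ≠ 0) :
    ∃ t j, t < n ∧ j < m ∧ u = t * m + j + 1 := by
  have hm : 0 < m := by
    rcases Nat.eq_zero_or_pos m with rfl | h1
    · omega
    · exact h1
  refine ⟨(u - 1) / m, (u - 1) % m, ?_, Nat.mod_lt _ hm, ?_⟩
  · rw [Nat.div_lt_iff_lt_mul hm]; omega
  · have := Nat.div_add_mod' (u - 1) m
    omega

/-! ### Critical blocks -/

theorem noForbidden_block_iff (c : PathConfig n k) (i : Fin n) :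
    NoForbidden (univ : Finset {j : Fin (k - 1 + 1) // j ≠ 0}) (block c i) ↔
      NoForbidden (range (k - 1)) fun j => val c (i.1 * (k - 1) + j + 1) := by
  have hval : ∀ j : {j : Fin (k - 1 + 1) // j ≠ 0},
      val c (i.1 * (k - 1) + j.1.1) = block c i j := fun j => by
    rw [block, ← val_coe c]
  have hj0 : ∀ j : {j : Fin (k - 1 + 1) // j ≠ 0}, j.1.1 ≠ 0 := fun j e => j.2 (Fin.ext e)
  constructor
  · intro h F hF hne
    have hlt : ∀ j ∈ F, j < k - 1 := fun j hj => mem_range.1 (hF hj)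
    let e : F ↪ {j : Fin (k - 1 + 1) // j ≠ 0} :=
      ⟨fun j => ⟨⟨j.1 + 1, by have := hlt j.1 j.2; omega⟩, fun e => by
        have := congrArg Fin.val e; simp at this⟩, fun x y hxy => by
        simp only [Subtype.mk.injEq, Fin.mk.injEq] at hxy
        exact Subtype.ext (by omega)⟩
    obtain ⟨j, hj, hle⟩ := h (F.attach.map e) (subset_univ _) (by simpa using hne)
    obtain ⟨x, -, rfl⟩ := mem_map.1 hj
    refine ⟨x.1, x.2, ?_⟩
    rw [card_map, card_attach, ← hval] at hle
    exact hle
  · intro h F _ hne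
    let e : {j : Fin (k - 1 + 1) // j ≠ 0} ↪ ℕ := ⟨fun j => j.1.1 - 1, fun x y hxy => by
      have h1 := hj0 x
      have h2 := hj0 y
      simp only at hxy
      exact Subtype.ext (Fin.ext (by omega))⟩
    obtain ⟨j, hj, hle⟩ := h (F.map e) (by
      intro j hj
      obtain ⟨x, -, rfl⟩ := mem_map.1 hj
      have h1 := hj0 x
      have h2 := x.1.2
      have h3 : e x = x.1.1 - 1 := rfl
      rw [mem_range, h3]
      omega) (by simpa using hne)
    obtain ⟨x, hx, rfl⟩ := mem_map.1 hj
    refine ⟨x, hx, ?_⟩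
    rw [card_map] at hle
    rw [← hval]
    have h1 := hj0 x
    have h3 : e x = x.1.1 - 1 := rfl
    have h2 : i.1 * (k - 1) + e x + 1 = i.1 * (k - 1) + x.1.1 := by omega
    simpa only [h2] using hle

theorem val_lt_of_stable (hk : 2 ≤ k) {c : PathConfig n k} (hc : Stable k c) (u : ℕ) :
    val c u < k - 1 := by
  unfold val
  split_ifs with h
  · exact hc _
  · omega

theorem noForbidden_of_mem_pathB {s : ℕ} {c : PathConfig n k} (hc : c ∈ pathB n k s) {t : ℕ}
    (hts : t < s) (htn : t < n) :
    NoForbidden (range (k - 1)) fun j => val c (t * (k - 1) + j + 1) :=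
  (noForbidden_block_iff c ⟨t, htn⟩).1 <|
    noForbidden_of_graphCritical_complete (hc.2.1 ⟨t, htn⟩ hts)

theorem exists_forbidden_of_mem_pathB {s : ℕ} {c : PathConfig n k} (hc : c ∈ pathB n k s)
    (hsn : s < n) : ∃ F ⊆ range (k - 1), F.Nonempty ∧
      ∀ j ∈ F, val c (s * (k - 1) + j + 1) + 1 < F.card := by
  by_contra! h
  refine hc.2.2 ⟨s, hsn⟩ rfl (graphCritical_complete_of_noForbidden ?_ ?_)
  · intro v
    rw [Fintype.card_fin]
    exact hc.1 _
  · rw [noForbidden_block_iff]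
    intro F hF hne
    exact h F hF hne

/-! ### Counting firings along a directed path of the firing graph -/

/-- The net number of dollars which have left the first vertex of the edge number `t` through this
edge, when that vertex has fired `B t` times on the edge and the other ones `a t j` times. -/
def flow (k : ℕ) (a : ℕ → ℕ → ℤ) (B : ℕ → ℤ) (t : ℕ) : ℤ :=
  (k - 1 : ℕ) * B t - ∑ j ∈ range (k - 1), a t j

/-- Numbers of firings leading from `c₀` to `c`: the first vertex of the edge number `t` has fired
`B t` times on this edge, its vertex number `j + 1` has fired `a t j` times on it. -/
structure PathCount (s : ℕ) (F : Finset ℕ) (c₀ c : PathConfig n k)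
    (a : ℕ → ℕ → ℤ) (B : ℕ → ℤ) : Prop where
  eq : ∀ t j, t < n → j < k - 1 →
    (val c (t * (k - 1) + j + 1) : ℤ) + ((k - 1 : ℕ) + 1) * a t j +
      (if j + 1 = k - 1 then flow k a B (t + 1) else 0) =
    val c₀ (t * (k - 1) + j + 1) + B t + ∑ i ∈ range (k - 1), a t i
  le : ∀ t j, j < k - 1 → a t j ≤ B t
  lt : ∀ j ∈ F, 1 ≤ B s → a s j + 1 ≤ B s
  nonneg : ∀ t j, 0 ≤ a t j
  nonneg' : ∀ t, 0 ≤ B t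
  flow_end : flow k a B n = 0

theorem PathCount.flow_nonneg {s : ℕ} {F : Finset ℕ} {c₀ c : PathConfig n k}
    {a : ℕ → ℕ → ℤ} {B : ℕ → ℤ} (h : PathCount s F c₀ c a B) (t : ℕ) : 0 ≤ flow k a B t := by
  have := Finset.sum_le_card_nsmul (range (k - 1)) (a t) (B t)
    fun j hj => h.le t j (mem_range.1 hj)
  rw [card_range, nsmul_eq_mul] at this
  exact sub_nonneg.2 this

/-- Dropping the nonnegative flow into the next edge leaves the balance of a complete graph whose
bank is the first vertex of the edge. This is the form needed by `count_lt_of_fire` and its variant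
for forbidden sets. -/
theorem PathCount.eq_le {s : ℕ} {F : Finset ℕ} {c₀ c : PathConfig n k}
    {a : ℕ → ℕ → ℤ} {B : ℕ → ℤ} (h : PathCount s F c₀ c a B) {t j : ℕ} (ht : t < n)
    (hj : j < k - 1) :
    (val c (t * (k - 1) + j + 1) : ℤ) + ((range (k - 1)).card + 1) * a t j ≤
    val c₀ (t * (k - 1) + j + 1) + B t + ∑ i ∈ range (k - 1), a t i := by
  have h1 := h.eq t j ht hj
  have h2 := h.flow_nonneg (t + 1)
  rw [card_range]
  split_ifs at h1 <;> linarith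

theorem PathCount.fire_left {s : ℕ} {F : Finset ℕ} {c₀ c d : PathConfig n k}
    {a : ℕ → ℕ → ℤ} {B : ℕ → ℤ} (h : PathCount s F c₀ c a B)
    (h₀ : ∀ u, val c₀ u < k - 1) (hF : F ⊆ range (k - 1))
    (hF' : ∀ j ∈ F, val c₀ (s * (k - 1) + j + 1) + 1 < F.card)
    {t j : ℕ} (ht : t < n) (hj : j < k - 1) (hfire : k - 1 ≤ val c (t * (k - 1) + j + 1))
    (hd : ∀ u, u < n * (k - 1) + 1 → u ≠ 0 → val d u =
      if u = t * (k - 1) + j + 1 then val c u - (k - 1) else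
      if t * (k - 1) ≤ u ∧ u ≤ (t + 1) * (k - 1) then val c u + 1 else val c u) :
    PathCount s F c₀ d (fun t' j' => a t' j' + if t' = t ∧ j' = j then 1 else 0) B := by
  have hsum : ∀ t', ∑ j' ∈ range (k - 1), (a t' j' + if t' = t ∧ j' = j then 1 else 0) =
      ∑ j' ∈ range (k - 1), a t' j' + if t' = t then 1 else 0 := by
    intro t'
    rw [sum_add_distrib]
    by_cases h1 : t' = t
    · simp [h1, hj]
    · simp [h1]
  have hflow : ∀ t', flow k (fun t' j' => a t' j' + if t' = t ∧ j' = j then 1 else 0) B t' =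
      flow k a B t' - if t' = t then 1 else 0 := by
    intro t'
    simp only [flow, hsum]
    ring
  have h1 : a t j + 1 ≤ B t := by
    refine count_lt_of_fire (s := range (k - 1)) (a := a t)
      (c₀ := val c₀ (t * (k - 1) + j + 1)) (c := val c (t * (k - 1) + j + 1))
      (fun i hi => h.le t i (mem_range.1 hi)) (mem_range.2 hj) ?_ (h.eq_le ht hj) ?_
    · rw [card_range]; exact_mod_cast h₀ _
    · rw [card_range]; exact_mod_cast hfire
  refine ⟨?_, ?_, ?_, ?_, h.nonneg', ?_⟩
  · intro t' j' ht' hj'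
    have heq := h.eq t' j' ht' hj'
    rw [hd _ (pos_lt ht' hj') (Nat.succ_ne_zero _)]
    simp only [hsum, hflow, pos_inj hj hj', pos_mem hj']
    by_cases h2 : t' = t ∧ j' = j
    · obtain ⟨rfl, rfl⟩ := h2
      have h3 : t' + 1 ≠ t' := by omega
      simp only [and_self, if_true, h3, if_false, sub_zero]
      push_cast [Nat.cast_sub hfire]
      linarith
    · simp only [h2, if_false]
      by_cases h3 : t' = t
      · subst h3
        have h4 : t' + 1 ≠ t' := by omega
        simp only [true_or, if_true, h4, if_false, sub_zero]
        push_cast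
        linarith
      · by_cases h4 : t' + 1 = t <;> by_cases h5 : j' + 1 = k - 1 <;>
        · simp only [h3, h4, h5, if_true, if_false, false_or, and_true, and_false,
            or_self, sub_zero] at heq ⊢
          push_cast
          linarith
  · intro t' j' hj'
    split_ifs with h2
    · rw [h2.1, h2.2]; exact h1
    · rw [add_zero]; exact h.le t' j' hj'
  · intro i hi hB
    split_ifs with h2
    · obtain ⟨rfl, rfl⟩ := h2
      have : a s i + 2 ≤ B s := by
        refine count_lt_of_fire_of_forbidden (s := range (k - 1)) (a := a s) (F := F)
          (c₀ := val c₀ (s * (k - 1) + i + 1)) (c := val c (s * (k - 1) + i + 1)) hF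
          (fun i hi => h.le s i (mem_range.1 hi)) (fun i hi => h.lt i hi hB) hi ?_
          (h.eq_le ht hj) ?_
        · exact_mod_cast hF' i hi
        · rw [card_range]; exact_mod_cast hfire
      linarith
    · rw [add_zero]; exact h.lt i hi hB
  · intro t' j'
    have := h.nonneg t' j'
    split_ifs <;> omega
  · rw [hflow, h.flow_end, if_neg (by omega), sub_zero]

/-- The case `t = 0` is the firing of the bank, which needs no dollars; for `t ≠ 0` the fired vertex
is the last one of the preceding edge, and the flow term in its balance records the change. -/
theorem PathCount.fire_right {s : ℕ} {F : Finset ℕ} {c₀ c d : PathConfig n k}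
    {a : ℕ → ℕ → ℤ} {B : ℕ → ℤ} (h : PathCount s F c₀ c a B) (hF : F ⊆ range (k - 1))
    {t : ℕ} (ht : t < n) (hfire : t ≠ 0 → k - 1 ≤ val c (t * (k - 1)))
    (hd : ∀ u, u < n * (k - 1) + 1 → u ≠ 0 → val d u =
      if u = t * (k - 1) then val c u - (k - 1) else
      if t * (k - 1) ≤ u ∧ u ≤ (t + 1) * (k - 1) then val c u + 1 else val c u) :
    PathCount s F c₀ d a (fun t' => B t' + if t' = t then 1 else 0) := by
  have hflow : ∀ t', flow k a (fun t' => B t' + if t' = t then 1 else 0) t' =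
      flow k a B t' + if t' = t then ((k - 1 : ℕ) : ℤ) else 0 := by
    intro t'
    simp only [flow]
    split_ifs <;> ring
  refine ⟨?_, ?_, ?_, h.nonneg, ?_, ?_⟩
  · intro t' j' ht' hj'
    have heq := h.eq t' j' ht' hj'
    rw [hd _ (pos_lt ht' hj') (Nat.succ_ne_zero _)]
    simp only [hflow, pos_eq_joint hj', pos_mem hj']
    by_cases h2 : t' + 1 = t ∧ j' + 1 = k - 1
    · have h3 : t' ≠ t := by omega
      have hf : k - 1 ≤ val c (t' * (k - 1) + j' + 1) := by
        rw [(pos_eq_joint hj').2 h2]; exact hfire (by omega)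
      simp only [h2, and_self, if_true, h3, if_false, add_zero] at heq ⊢
      push_cast [Nat.cast_sub hf]
      linarith
    · simp only [h2, if_false, or_false]
      by_cases h3 : t' = t
      · subst h3
        have h4 : t' + 1 ≠ t' := by omega
        simp only [if_true, h4, if_false, add_zero]
        push_cast
        linarith
      · by_cases h4 : t' + 1 = t <;> by_cases h5 : j' + 1 = k - 1
        · exact absurd ⟨h4, h5⟩ h2
        all_goals
          simp only [h3, h4, h5, if_true, if_false, add_zero] at heq ⊢
          linarith
  · intro t' j' hj'
    have := h.le t' j' hj'
    split_ifs <;> omega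
  · intro i hi _
    by_cases h2 : s = t
    · have := h.le s i (mem_range.1 (hF hi))
      simp only [h2, if_true] at this ⊢
      omega
    · simp only [h2, if_false, add_zero] at *
      exact h.lt i hi ‹_›
  · intro t'
    have := h.nonneg' t'
    split_ifs <;> omega
  · rw [hflow, h.flow_end, if_neg (by omega), add_zero]

theorem PathCount.arrow {s : ℕ} {F : Finset ℕ} {c₀ c d : PathConfig n k}
    {a : ℕ → ℕ → ℤ} {B : ℕ → ℤ} (h : PathCount s F c₀ c a B) (hk : 2 ≤ k)
    (h₀ : ∀ u, val c₀ u < k - 1) (hF : F ⊆ range (k - 1))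
    (hF' : ∀ j ∈ F, val c₀ (s * (k - 1) + j + 1) + 1 < F.card)
    {v : PathVertex n k} {t : ℕ} (ht : t < n)
    (harr : Arrow (pathEdges n k) k 0 c₀ c v (pathEdge n k (t + 1)) d) :
    ∃ a' B', PathCount s F c₀ d a' B' ∧ (∀ i, B i ≤ B' i) ∧ (v.1 = t * (k - 1) → 1 ≤ B' t) := by
  obtain ⟨-, hve, harr⟩ := harr
  rw [mem_pathEdge] at hve
  by_cases hvt : v.1 = t * (k - 1)
  · have hR : PathCount s F c₀ d a (fun t' => B t' + if t' = t then 1 else 0) := by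
      refine h.fire_right hF ht ?_ ?_
      · intro ht0
        rcases harr with ⟨-, rfl, -⟩ | ⟨hv, hg, -⟩
        · have : t * (k - 1) ≠ 0 := Nat.mul_ne_zero ht0 (by omega)
          exact absurd hvt.symm this
        · have : k - 1 ≤ c ⟨v, hv⟩ := hg.1
          rw [← val_coe c] at this
          rwa [← hvt]
      · intro u hu hu0
        rcases harr with ⟨-, rfl, rfl⟩ | ⟨hv, hg, rfl⟩
        · have hut : u ≠ t * (k - 1) := fun e => hu0 (e.trans hvt.symm)
          rw [val_bankFire _ _ hu hu0, if_neg hut]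
        · rw [val_fireOn _ _ _ hu hu0, hvt]
    refine ⟨_, _, hR, fun i => ?_, fun _ => ?_⟩
    · split_ifs <;> omega
    · have := h.nonneg' t
      simp only [if_true]; omega
  · have hv0 : v.1 ≠ 0 := by omega
    obtain ⟨j, hj⟩ : ∃ j, v.1 = t * (k - 1) + j + 1 :=
      ⟨v.1 - t * (k - 1) - 1, by omega⟩
    have hjk : j < k - 1 := by
      have := hve.2
      rw [Nat.succ_mul] at this
      omega
    rcases harr with ⟨-, rfl, -⟩ | ⟨hv, hg, rfl⟩
    · exact absurd rfl hv0
    refine ⟨_, B, h.fire_left h₀ hF hF' ht hjk ?_ ?_, fun _ => le_rfl, fun h => absurd h hvt⟩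
    · have : k - 1 ≤ c ⟨v, hv⟩ := hg.1
      rw [← val_coe c] at this
      rwa [← hj]
    · intro u hu hu0
      rw [val_fireOn _ _ _ hu hu0, hj]

theorem PathCount.reach {s : ℕ} {F : Finset ℕ} {c₀ c d : PathConfig n k}
    {a : ℕ → ℕ → ℤ} {B : ℕ → ℤ} (h : PathCount s F c₀ c a B) (hk : 2 ≤ k)
    (h₀ : ∀ u, val c₀ u < k - 1) (hF : F ⊆ range (k - 1))
    (hF' : ∀ j ∈ F, val c₀ (s * (k - 1) + j + 1) + 1 < F.card)
    (hr : Reach (pathEdges n k) k 0 c₀ c d) :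
    ∃ a' B', PathCount s F c₀ d a' B' ∧ ∀ i, B i ≤ B' i := by
  induction hr with
  | refl => exact ⟨a, B, h, fun _ => le_rfl⟩
  | tail _ harr ih =>
    obtain ⟨a', B', h', hB⟩ := ih
    obtain ⟨v, e, harr⟩ := harr
    obtain ⟨t, ht, rfl⟩ := mem_image.1 harr.1
    rw [mem_Icc] at ht
    obtain ⟨t, rfl⟩ := Nat.exists_eq_add_of_le' ht.1
    obtain ⟨a'', B'', h'', hB', -⟩ := h'.arrow hk h₀ hF hF' (t := t) (by omega) harr
    exact ⟨a'', B'', h'', fun i => (hB i).trans (hB' i)⟩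

theorem exists_pathCount {s : ℕ} {F : Finset ℕ} {c₀ c : PathConfig n k} (hk : 2 ≤ k)
    (h₀ : ∀ u, val c₀ u < k - 1) (hF : F ⊆ range (k - 1))
    (hF' : ∀ j ∈ F, val c₀ (s * (k - 1) + j + 1) + 1 < F.card)
    (hc : c ∈ pathG' n k s c₀) :
    ∃ a B, PathCount s F c₀ c a B ∧ 1 ≤ B s := by
  obtain ⟨hsn, c₁, hc₁, c₂, harr, hr⟩ := hc
  have h0 : PathCount s F c₀ c₀ 0 0 :=
    ⟨by intros; simp [flow], by simp, by simp, by simp, by simp, by simp [flow]⟩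
  obtain ⟨a, B, h, -⟩ := h0.reach hk h₀ hF hF' hc₁
  obtain ⟨a', B', h', -, hB'⟩ := h.arrow hk h₀ hF hF' hsn harr
  obtain ⟨a'', B'', h'', hB''⟩ := h'.reach hk h₀ hF hF' hr
  refine ⟨a'', B'', h'', (hB' ?_).trans (hB'' s)⟩
  rw [Fin.val_ofNat]
  refine Nat.mod_eq_of_lt (Nat.lt_succ_of_le (Nat.mul_le_mul_right _ hsn.le))

theorem weight_eq_sum (c : PathConfig n k) :
    weight c = ∑ t ∈ range n, ∑ j ∈ range (k - 1), val c (t * (k - 1) + j + 1) := by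
  have h1 : weight c = ∑ u ∈ range (n * (k - 1)), val c (u + 1) := by
    unfold weight
    refine sum_bij (fun u _ => u.1.1 - 1) ?_ ?_ ?_ ?_
    · intro u _
      have := u.1.2
      have := ne_zero_val u
      rw [mem_range]; omega
    · intro u _ v _ huv
      have := ne_zero_val u
      have := ne_zero_val v
      exact Subtype.ext (Fin.ext (by omega))
    · intro u hu
      rw [mem_range] at hu
      exact ⟨⟨⟨u + 1, by omega⟩, fun e => by simpa using congrArg Fin.val e⟩, mem_univ _, rfl⟩
    · intro u _
      rw [Nat.sub_add_cancel (Nat.pos_of_ne_zero (ne_zero_val u)), val_coe]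
  have h2 : ∀ (f : ℕ → ℕ) (m N : ℕ), ∑ u ∈ range (N * m), f u =
      ∑ t ∈ range N, ∑ j ∈ range m, f (t * m + j) := by
    intro f m N
    induction N with
    | zero => simp
    | succ N ih => rw [Nat.succ_mul, sum_range_add, ih, sum_range_succ]
  rw [h1, h2]

/-- Edge number `t` gains the flow entering at its first vertex and loses the flow into the next
edge. The sum telescopes, and nothing leaves the last edge. -/
theorem PathCount.weight_eq {s : ℕ} {F : Finset ℕ} {c₀ c : PathConfig n k}
    {a : ℕ → ℕ → ℤ} {B : ℕ → ℤ} (h : PathCount s F c₀ c a B) (hk : 2 ≤ k) :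
    (weight c : ℤ) = weight c₀ + flow k a B 0 := by
  rw [weight_eq_sum, weight_eq_sum]
  push_cast
  have h1 : ∀ t ∈ range n,
      ∑ j ∈ range (k - 1), (val c (t * (k - 1) + j + 1) : ℤ) =
        ∑ j ∈ range (k - 1), (val c₀ (t * (k - 1) + j + 1) : ℤ) +
          (flow k a B t - flow k a B (t + 1)) := by
    intro t ht
    have h2 : ∀ j ∈ range (k - 1), (val c (t * (k - 1) + j + 1) : ℤ) =
        val c₀ (t * (k - 1) + j + 1) + (B t + ∑ i ∈ range (k - 1), a t i) -
          ((k - 1 : ℕ) + 1) * a t j - (if j = k - 2 then flow k a B (t + 1) else 0) := by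
      intro j hj
      have h3 := h.eq t j (mem_range.1 ht) (mem_range.1 hj)
      have h4 : j + 1 = k - 1 ↔ j = k - 2 := by omega
      simp only [h4] at h3
      linarith
    rw [sum_congr rfl h2, sum_sub_distrib, sum_sub_distrib, sum_add_distrib, sum_const,
      ← mul_sum, sum_ite_eq', if_pos (mem_range.2 (by omega)), card_range, nsmul_eq_mul]
    simp only [flow]
    ring
  rw [sum_congr rfl h1, sum_add_distrib, sum_range_sub', h.flow_end, sub_zero]

/-- Zero flow together with `a t j ≤ B t` forces every vertex of the edge to have fired on it
exactly as often as the first one, so these firings cancel. -/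
theorem PathCount.eq_of_flow_eq_zero {s : ℕ} {F : Finset ℕ} {c₀ c : PathConfig n k}
    {a : ℕ → ℕ → ℤ} {B : ℕ → ℤ} (h : PathCount s F c₀ c a B) {t j : ℕ} (ht : t < n)
    (hj : j < k - 1) (h0 : flow k a B t = 0) :
    (val c (t * (k - 1) + j + 1) : ℤ) +
      (if j + 1 = k - 1 then flow k a B (t + 1) else 0) = val c₀ (t * (k - 1) + j + 1) := by
  have h1 := h.eq t j ht hj
  have h2 : a t j = B t := by
    by_contra hne
    have hlt : a t j < B t := lt_of_le_of_ne (h.le t j hj) hne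
    have h3 : ∑ i ∈ range (k - 1), a t i < ∑ _i ∈ range (k - 1), B t :=
      sum_lt_sum (fun i hi => h.le t i (mem_range.1 hi)) ⟨j, mem_range.2 hj, hlt⟩
    rw [sum_const, card_range, nsmul_eq_mul] at h3
    unfold flow at h0
    linarith
  unfold flow at h0
  rw [h2] at h1
  linarith

theorem prec_of_mem_pathG' {s : ℕ} {c₀ c : PathConfig n k} (hk : 2 ≤ k)
    (hc₀ : c₀ ∈ pathB n k s) (hc : c ∈ pathG' n k s c₀) : Prec c₀ c := by
  obtain ⟨F, hF, ⟨j₀, hj₀⟩, hF'⟩ := exists_forbidden_of_mem_pathB hc₀ hc.1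
  obtain ⟨a, B, h, hB⟩ := exists_pathCount hk (val_lt_of_stable hk hc₀.1) hF hF' hc
  -- The forbidden vertex `j₀` has fired strictly less often than the first vertex of its edge.
  have hs : 0 < flow k a B s := by
    have h3 : ∑ i ∈ range (k - 1), a s i < ∑ _i ∈ range (k - 1), B s :=
      sum_lt_sum (fun i hi => h.le s i (mem_range.1 hi))
        ⟨j₀, hF hj₀, by have := h.lt j₀ hj₀ hB; omega⟩
    rw [sum_const, card_range, nsmul_eq_mul] at h3
    unfold flow
    linarith
  have hex : ∃ t, 0 < flow k a B t := ⟨s, hs⟩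
  classical
  obtain ⟨t, ht, hts, hmin⟩ : ∃ t, 0 < flow k a B t ∧ t ≤ s ∧ ∀ t' < t, flow k a B t' = 0 :=
    ⟨Nat.find hex, Nat.find_spec hex, Nat.find_min' hex hs, fun t' ht' =>
      le_antisymm (not_lt.1 (Nat.find_min hex ht')) (h.flow_nonneg t')⟩
  have hw := h.weight_eq hk
  -- If dollars enter from the bank, the weight grows. Otherwise the weights agree and the witness
  -- for the order is the joint `(t + 1) * (k - 1)`, which pays the first positive flow.
  rcases t with _ | t
  · left; omega
  right
  rw [hmin 0 (Nat.succ_pos t), add_zero] at hw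
  have htn : t + 1 < n := lt_of_le_of_lt hts hc.1
  have hpos : t * (k - 1) + (k - 2) + 1 = (t + 1) * (k - 1) := by
    rw [Nat.succ_mul]; omega
  have hlt : (t + 1) * (k - 1) < n * (k - 1) + 1 :=
    Nat.lt_succ_of_le (Nat.mul_le_mul_right _ htn.le)
  have hne : (t + 1) * (k - 1) ≠ 0 := by omega
  refine ⟨by omega, ⟨⟨_, hlt⟩, fun e => hne (congrArg Fin.val e)⟩, ?_, ?_⟩
  · intro i hi
    have hi' : i.1.1 < (t + 1) * (k - 1) := hi
    obtain ⟨t', j, ht', hj, hij⟩ := exists_pos i.1.2 (ne_zero_val i)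
    have htt : t' < t + 1 := by
      by_contra hge
      have := Nat.mul_le_mul_right (k - 1) (not_lt.1 hge)
      omega
    have h1 := h.eq_of_flow_eq_zero ht' hj (hmin t' htt)
    have h2 : (if j + 1 = k - 1 then flow k a B (t' + 1) else 0) = 0 := by
      split_ifs with hjk
      · refine hmin _ (lt_of_le_of_ne htt fun e => ?_)
        rw [hij, ← e, Nat.succ_mul] at hi'
        omega
      · rfl
    rw [h2, add_zero, ← hij, val_coe, val_coe] at h1
    exact_mod_cast h1.symm
  · rw [← val_of_lt c hlt hne, ← val_of_lt c₀ hlt hne]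
    have h1 := h.eq_of_flow_eq_zero (t := t) (j := k - 2) (by omega) (by omega)
      (hmin t (Nat.lt_succ_self t))
    rw [if_pos (by omega), hpos] at h1
    omega

end Path

end Hyperpath

namespace Hyperpath

open MvPolynomial Finset

/-! ### Linear algebra with a transcendental scalar. -/

section General

/-- A finite-dimensional space of vectors over a subfield which is stable under multiplication by a
transcendental scalar is zero. -/
theorem eq_zero_of_smul_mem_span {F K M : Type*} [Field F] [Field K] [Algebra F K]
    [AddCommGroup M] [Module F M] [Module K M] [IsScalarTower F K M] {lam : K}
    (hlam : Transcendental F lam) {S : Set M} (hS : S.Finite)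
    (h : ∀ y ∈ S, lam • y ∈ Submodule.span F S) {y : M} (hy : y ∈ S) : y = 0 := by
  let U := Submodule.span F S
  have : Module.Finite F U := Module.Finite.span_of_finite F hS
  let f : M →ₗ[F] M := (Algebra.lsmul F F M lam)
  have hf : ∀ x ∈ U, f x ∈ U := by
    intro x hx
    have : U ≤ U.comap f := Submodule.span_le.2 h
    exact this hx
  -- A monic `p` annihilates multiplication by `lam` on the finite-dimensional `U`, so the scalar
  -- `p(lam)` kills `U`; transcendence makes this scalar nonzero.
  obtain ⟨p, hp, hp0⟩ := Algebra.IsIntegral.isIntegral (R := F) (f.restrict hf)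
  have hpow : ∀ (q : Polynomial F) (x : U),
      ((Polynomial.aeval (f.restrict hf) q x : U) : M) = Polynomial.aeval lam q • (x : M) := by
    intro q
    induction q using Polynomial.induction_on' with
    | add q r hq hr => intro x; simp [hq, hr, add_smul]
    | monomial i b =>
      intro x
      have : ∀ j : ℕ, (((f.restrict hf ^ j) x : U) : M) = lam ^ j • (x : M) := by
        intro j
        induction j with
        | zero => simp
        | succ j ih =>
          rw [pow_succ', Module.End.mul_apply, LinearMap.coe_restrict_apply, ih, pow_succ', mul_smul]
          rfl
      simp [Polynomial.aeval_monomial, this, mul_smul]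
  have hy' : y ∈ U := Submodule.subset_span hy
  have h1 := hpow p ⟨y, hy'⟩
  rw [← Polynomial.aeval_def] at hp0
  rw [hp0] at h1
  have h2 : Polynomial.aeval lam p ≠ 0 := fun e => hp.ne_zero (by
    by_contra hne
    exact hlam ⟨p, hne, e⟩)
  exact (smul_eq_zero.1 h1.symm).resolve_left h2

end General

/-! ### The relations of the quotient algebra as firing rules. -/

section Relations

variable {V : Type*} [DecidableEq V] [Fintype V] (E : Finset (Finset V)) (k : ℕ) (w : V)
  {K : Type*} [Field K] (lam : K)

theorem smallF_eq (v : V) : smallF E k w lam v =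
    C lam * (if h : v = w then 1 else X ⟨v, h⟩) ^ (k - 1) -
      ∑ e ∈ E with v ∈ e, ∏ u : {u : V // u ≠ w}, X u ^ (if u.1 ∈ e.erase v then 1 else 0) := by
  rw [smallF, bigF, map_sub, map_mul, map_pow, map_sum, aeval_X]
  congr 1
  · simp [MvPolynomial.algebraMap_eq]
  · refine sum_congr rfl fun e _ => ?_
    rw [map_prod]
    simp only [aeval_X]
    have h1 : ∀ u : V, (if h : u = w then (1 : MvPolynomial {u : V // u ≠ w} K) else X ⟨u, h⟩) ^
        (if u ∈ e.erase v then 1 else 0) =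
        if u ∈ e.erase v then (if h : u = w then 1 else X ⟨u, h⟩) else 1 := by
      intro u; split_ifs <;> simp
    have h2 : ∏ u ∈ e.erase v,
        (if h : u = w then (1 : MvPolynomial {u : V // u ≠ w} K) else X ⟨u, h⟩) =
        ∏ u : V, (if h : u = w then (1 : MvPolynomial {u : V // u ≠ w} K) else X ⟨u, h⟩) ^
          (if u ∈ e.erase v then 1 else 0) := by
      rw [prod_congr rfl fun u _ => h1 u, prod_ite_mem, univ_inter]
    rw [h2, ← Fintype.prod_subtype_mul_prod_subtype (fun u => u ≠ w)]
    have h3 : ∏ u : {u : V // ¬ u ≠ w},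
        (if h : u.1 = w then (1 : MvPolynomial {u : V // u ≠ w} K) else X ⟨u.1, h⟩) ^
          (if u.1 ∈ e.erase v then 1 else 0) = 1 :=
      prod_eq_one fun u _ => by rw [dif_pos (not_not.1 u.2), one_pow]
    rw [h3, mul_one]
    refine prod_congr rfl fun u _ => ?_
    rw [dif_neg u.2]

/-- This is the relation `f_v` multiplied by the monomial `x^c / x_v^(k-1)`. -/
theorem smul_mono (c : Config w) (v : {u : V // u ≠ w}) (hv : k - 1 ≤ c v) :
    lam • mono E k w lam c = ∑ e ∈ E with v.1 ∈ e, mono E k w lam (fireOn k c v e) := by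
  have hmem : smallF E k w lam v.1 ∈ pIdeal E k w lam := Ideal.subset_span ⟨v, rfl⟩
  have h0 := Ideal.mul_mem_left _ (∏ u, X u ^ (c u - if u = v then k - 1 else 0)) hmem
  rw [smallF_eq, dif_neg v.2, mul_sub, mul_sum] at h0
  have h1 : (∏ u, X u ^ (c u - if u = v then k - 1 else 0)) * (C lam * X v ^ (k - 1)) =
      lam • ∏ u, (X u : MvPolynomial {u : V // u ≠ w} K) ^ c u := by
    have h2 : (X v : MvPolynomial {u : V // u ≠ w} K) ^ (k - 1) =
        ∏ u : {u : V // u ≠ w}, X u ^ (if u = v then k - 1 else 0) := by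
      simp
    rw [mul_left_comm, h2, ← prod_mul_distrib, smul_eq_C_mul]
    congr 1
    refine prod_congr rfl fun u _ => ?_
    rw [← pow_add]
    congr 1
    split_ifs with h
    · subst h; omega
    · omega
  have h2 : ∀ e ∈ E.filter (v.1 ∈ ·), (∏ u, X u ^ (c u - if u = v then k - 1 else 0)) *
      ∏ u : {u : V // u ≠ w}, (X u : MvPolynomial {u : V // u ≠ w} K) ^
        (if u.1 ∈ e.erase v.1 then 1 else 0) = ∏ u, X u ^ fireOn k c v e u := by
    intro e _
    rw [← prod_mul_distrib]
    refine prod_congr rfl fun u _ => ?_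
    rw [← pow_add]
    congr 1
    unfold fireOn
    by_cases h : u = v
    · subst h; simp
    · have h3 : u.1 ≠ v.1 := fun e => h (Subtype.ext e)
      by_cases h4 : u.1 ∈ e <;> simp [h, h3, h4]
  rw [h1, sum_congr rfl h2, ← Ideal.Quotient.eq] at h0
  rw [map_sum] at h0
  exact h0

theorem bankF_mul_mono (c : Config w) :
    bankF E k w lam * mono E k w lam c = lam • mono E k w lam c -
      ∑ e ∈ E with w ∈ e, mono E k w lam (bankFire c e) := by
  unfold bankF mono
  rw [← map_sum, ← map_mul, smallF_eq, dif_pos rfl, one_pow, mul_one, sub_mul, sum_mul, map_sub,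
    ← smul_eq_C_mul]
  congr 1
  congr 1
  refine sum_congr rfl fun e _ => ?_
  rw [← prod_mul_distrib]
  refine prod_congr rfl fun u _ => ?_
  rw [← pow_add]
  congr 1
  unfold bankFire
  by_cases h4 : u.1 ∈ e <;> simp [h4, u.2, add_comm]

/-- The vertex `v` loses `k - 1` dollars and at most `k - 1` other vertices gain one. Equality can
fail because a dollar sent to the bank is not counted. -/
theorem weight_fireOn_le (c : Config w) (v : {u : V // u ≠ w}) {e : Finset V} (hv : k - 1 ≤ c v)
    (hve : v.1 ∈ e) (he : e.card ≤ k) : weight (fireOn k c v e) ≤ weight c := by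
  have h1 : ∑ u, (fireOn k c v e u + if u = v then k - 1 else 0) =
      ∑ u, (c u + if u.1 ∈ e.erase v.1 then 1 else 0) := by
    refine sum_congr rfl fun u _ => ?_
    unfold fireOn
    by_cases h : u = v
    · subst h; simp; omega
    · have h3 : u.1 ≠ v.1 := fun e => h (Subtype.ext e)
      by_cases h4 : u.1 ∈ e <;> simp [h, h3, h4]
  rw [sum_add_distrib, sum_add_distrib, sum_ite_eq', if_pos (mem_univ v), sum_boole] at h1
  have h2 : (univ.filter fun u : {u : V // u ≠ w} => u.1 ∈ e.erase v.1).card ≤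
      (e.erase v.1).card := by
    refine card_le_card_of_injOn (fun u => u.1) (fun u hu => ?_) (Subtype.val_injective.injOn)
    exact (mem_filter.1 hu).2
  rw [card_erase_of_mem hve] at h2
  unfold weight
  simp only [Nat.cast_id] at h1
  omega

theorem finite_weight_le (N : ℕ) : {c : Config w | weight c ≤ N}.Finite := by
  refine (Set.Finite.pi' (t := fun _ : {u : V // u ≠ w} => Set.Iic N)
    fun _ => Set.finite_Iic N).subset fun c hc u => ?_
  exact (single_le_sum (fun _ _ => Nat.zero_le _) (mem_univ u)).trans hc

end Relations

/-! ### Reduction to stable monomials. -/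

section Span

variable {V : Type*} [LinearOrder V] [Fintype V] (E : Finset (Finset V)) (k : ℕ) (w : V)
  {F K : Type*} [Field F] [Field K] [Algebra F K] (lam : K)

theorem exists_isGreatest_of_not_stable {c : Config w} (hc : ¬ Stable k c) :
    ∃ v, IsGreatest {u : {u : V // u ≠ w} | k - 1 ≤ c u} v := by
  have hne : {u : {u : V // u ≠ w} | k - 1 ≤ c u}.Nonempty := by
    by_contra h
    refine hc fun u => ?_
    by_contra hu
    exact h ⟨u, not_lt.1 hu⟩
  obtain ⟨v, hv⟩ := (Set.toFinite {u : {u : V // u ≠ w} | k - 1 ≤ c u}).exists_maximal hne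
  exact ⟨v, hv.1, fun u hu => le_of_not_gt fun h => (hv.not_gt hu h).elim⟩

/-- The monomials of a finite set of configurations which is closed under the firings of the firing
graph are combinations of monomials of stable configurations of this set. -/
theorem mono_mem_span_stable (hlam : Transcendental F lam) {R : Set (Config w)} (hR : R.Finite)
    (hcl : ∀ c ∈ R, ∀ v, IsGreatest {u : {u : V // u ≠ w} | k - 1 ≤ c u} v → ∀ e ∈ E, v.1 ∈ e →
      fireOn k c v e ∈ R) {c : Config w} (hc : c ∈ R) :
    mono E k w lam c ∈ Submodule.span K (mono E k w lam '' {c | c ∈ R ∧ Stable k c}) := by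
  set W := Submodule.span K (mono E k w lam '' {c | c ∈ R ∧ Stable k c}) with hW
  -- In the quotient by `W`, stable monomials vanish, and `lam` times any other monomial of `R` is a
  -- sum of monomials of `R` with coefficients 1, which lie in `F`.
  have key := eq_zero_of_smul_mem_span (F := F) (M := QuotAlg E k w lam ⧸ W) hlam
    (hR.image fun c => W.mkQ (mono E k w lam c)) ?_ (Set.mem_image_of_mem _ hc)
  · simpa using key
  · rintro _ ⟨c, hc, rfl⟩
    by_cases hst : Stable k c
    · have : W.mkQ (mono E k w lam c) = 0 := by
        rw [Submodule.mkQ_apply, Submodule.Quotient.mk_eq_zero]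
        exact Submodule.subset_span ⟨c, ⟨hc, hst⟩, rfl⟩
      simp only [this, smul_zero, Submodule.zero_mem]
    · obtain ⟨v, hv⟩ := exists_isGreatest_of_not_stable k w hst
      simp only
      rw [← map_smul, smul_mono E k w lam c v hv.1, map_sum]
      refine Submodule.sum_mem _ fun e he => Submodule.subset_span ?_
      rw [mem_filter] at he
      exact ⟨_, hcl c hc v hv e he.1 he.2, rfl⟩

end Span

end Hyperpath

namespace Hyperpath

open Finset

/-! ### Edges through a vertex, reachability, and burning a critical edge. -/

section Edges

variable {n k : ℕ}

theorem card_pathEdge_le (hk : 1 ≤ k) (t : ℕ) : (pathEdge n k (t + 1)).card ≤ k := by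
  have h := card_le_card_of_injOn (s := pathEdge n k (t + 1))
    (t := Icc (t * (k - 1)) ((t + 1) * (k - 1))) (fun v => v.1)
    (fun v hv => mem_coe.2 (mem_Icc.2 (mem_pathEdge.1 hv))) Fin.val_injective.injOn
  rw [Nat.card_Icc, Nat.succ_mul] at h
  omega

theorem exists_of_mem_pathEdges {e : Finset (PathVertex n k)} (he : e ∈ pathEdges n k) :
    ∃ t < n, e = pathEdge n k (t + 1) := by
  obtain ⟨t, ht, rfl⟩ := mem_image.1 he
  rw [mem_Icc] at ht
  obtain ⟨t, rfl⟩ := Nat.exists_eq_add_of_le' ht.1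
  exact ⟨t, by omega, rfl⟩

theorem pathEdge_mem_pathEdges {t : ℕ} (ht : t < n) : pathEdge n k (t + 1) ∈ pathEdges n k :=
  mem_image_of_mem _ (mem_Icc.2 ⟨by omega, by omega⟩)

theorem mem_pathEdge_pos {t t' j : ℕ} (hj : j < k - 1) {v : PathVertex n k}
    (hv : v.1 = t * (k - 1) + j + 1) :
    v ∈ pathEdge n k (t' + 1) ↔ t = t' ∨ (t + 1 = t' ∧ j + 1 = k - 1) := by
  rw [mem_pathEdge, hv, pos_mem hj]

theorem filter_pathEdges_zero (hn : 1 ≤ n) (hk : 2 ≤ k) :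
    (pathEdges n k).filter ((0 : PathVertex n k) ∈ ·) = {pathEdge n k 1} := by
  ext e
  rw [mem_filter, mem_singleton]
  constructor
  · rintro ⟨he, h0⟩
    obtain ⟨t, -, rfl⟩ := exists_of_mem_pathEdges he
    have h1 : t * (k - 1) ≤ 0 := (mem_pathEdge.1 h0).1
    have h2 : t = 0 := by
      rcases Nat.mul_eq_zero.1 (Nat.le_zero.1 h1) with h | h <;> omega
    rw [h2]
  · rintro rfl
    exact ⟨pathEdge_mem_pathEdges hn, mem_pathEdge.2 (by simp)⟩

theorem filter_pathEdges_left {t j : ℕ} (ht : t < n) (hj : j < k - 1) {v : PathVertex n k}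
    (hv : v.1 = t * (k - 1) + j + 1) (h : j + 1 = k - 1 → t + 1 = n) :
    (pathEdges n k).filter (v ∈ ·) = {pathEdge n k (t + 1)} := by
  ext e
  rw [mem_filter, mem_singleton]
  constructor
  · rintro ⟨he, h0⟩
    obtain ⟨t', ht', rfl⟩ := exists_of_mem_pathEdges he
    rcases (mem_pathEdge_pos hj hv).1 h0 with rfl | ⟨h1, h2⟩
    · rfl
    · have := h h2; omega
  · rintro rfl
    exact ⟨pathEdge_mem_pathEdges ht, (mem_pathEdge_pos hj hv).2 (Or.inl rfl)⟩

theorem filter_pathEdges_joint {t j : ℕ} (ht : t + 1 < n) (hj : j + 1 = k - 1)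
    {v : PathVertex n k} (hv : v.1 = t * (k - 1) + j + 1) :
    (pathEdges n k).filter (v ∈ ·) = {pathEdge n k (t + 1), pathEdge n k (t + 1 + 1)} := by
  have hj' : j < k - 1 := by omega
  ext e
  rw [mem_filter, mem_insert, mem_singleton]
  constructor
  · rintro ⟨he, h0⟩
    obtain ⟨t', ht', rfl⟩ := exists_of_mem_pathEdges he
    rcases (mem_pathEdge_pos hj' hv).1 h0 with rfl | ⟨rfl, -⟩
    · exact Or.inl rfl
    · exact Or.inr rfl
  · rintro (rfl | rfl)
    · exact ⟨pathEdge_mem_pathEdges (by omega), (mem_pathEdge_pos hj' hv).2 (Or.inl rfl)⟩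
    · exact ⟨pathEdge_mem_pathEdges ht, (mem_pathEdge_pos hj' hv).2 (Or.inr ⟨rfl, hj⟩)⟩

theorem pathEdge_ne_succ {t : ℕ} (ht : t < n) (hk : 2 ≤ k) :
    pathEdge n k (t + 1) ≠ pathEdge n k (t + 1 + 1) := by
  intro h
  have hlt : t * (k - 1) < n * (k - 1) + 1 :=
    Nat.lt_succ_of_le (Nat.mul_le_mul_right _ ht.le)
  have h1 : (⟨t * (k - 1), hlt⟩ : PathVertex n k) ∈ pathEdge n k (t + 1) :=
    mem_pathEdge.2 ⟨le_rfl, Nat.mul_le_mul_right _ (by omega)⟩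
  rw [h, mem_pathEdge] at h1
  have h2 : (t + 1) * (k - 1) ≤ t * (k - 1) := h1.1
  rw [Nat.succ_mul] at h2
  omega

/-! ### Reachable configurations -/

/-- The bank fires only at `c₀` itself, and no other firing raises the weight, so the weight stays
bounded along every path. -/
theorem finite_firingVertices (hk : 1 ≤ k) (c₀ : PathConfig n k) :
    (firingVertices (pathEdges n k) k 0 c₀).Finite := by
  refine (finite_weight_le 0
    (weight c₀ + Fintype.card {u : PathVertex n k // u ≠ 0})).subset fun c hc => ?_
  induction hc with
  | refl => exact Nat.le_add_right _ _
  | tail _ h ih =>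
    obtain ⟨v, e, he, hve, ⟨hc, -, rfl⟩ | ⟨hv, hg, rfl⟩⟩ := h
    · rw [hc]
      have h1 := sum_le_card_nsmul (univ : Finset {u : PathVertex n k // u ≠ 0}) (fun _ => 1) 1
        (fun _ _ => le_rfl)
      have h2 : weight (bankFire c₀ e) ≤ ∑ u, (c₀ u + 1) :=
        sum_le_sum fun u _ => by unfold bankFire; split_ifs <;> omega
      rw [sum_add_distrib] at h2
      simp only [smul_eq_mul, mul_one, card_univ] at h1
      exact h2.trans (Nat.add_le_add_left h1 _)
    · obtain ⟨t, -, rfl⟩ := exists_of_mem_pathEdges he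
      exact (weight_fireOn_le k 0 _ ⟨v, hv⟩ hg.1 hve (card_pathEdge_le hk t)).trans ih

theorem pathG'_subset_firingVertices {s : ℕ} (c₀ : PathConfig n k) :
    pathG' n k s c₀ ⊆ firingVertices (pathEdges n k) k 0 c₀ := by
  rintro c ⟨-, c₁, hc₁, c₂, harr, hr⟩
  exact (Relation.ReflTransGen.tail hc₁ ⟨_, _, harr⟩).trans hr

theorem fireOn_mem_pathG' {s : ℕ} {c₀ c : PathConfig n k} (hc : c ∈ pathG' n k s c₀)
    {v : {u : PathVertex n k // u ≠ 0}}
    (hv : IsGreatest {u : {u : PathVertex n k // u ≠ 0} | k - 1 ≤ c u} v)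
    {e : Finset (PathVertex n k)} (he : e ∈ pathEdges n k) (hve : v.1 ∈ e) :
    fireOn k c v e ∈ pathG' n k s c₀ := by
  obtain ⟨hsn, c₁, hc₁, c₂, harr, hr⟩ := hc
  exact ⟨hsn, c₁, hc₁, c₂, harr, hr.tail ⟨v.1, e, he, hve, Or.inr ⟨v.2, hv, rfl⟩⟩⟩

/-! ### Burning an edge -/

/-- The configuration obtained from `d` when the first vertex of the edge number `j` and then its
vertices with numbers `i + 1`, `i ∈ U`, have been fired on this edge. -/
def burn (d : PathConfig n k) (j : ℕ) (U : Finset ℕ) : PathConfig n k := fun u =>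
  if u.1.1 = j * (k - 1) then d u - (k - 1) + U.card else
  if j * (k - 1) ≤ u.1.1 ∧ u.1.1 ≤ (j + 1) * (k - 1) then
    d u + 1 + U.card - if u.1.1 - j * (k - 1) - 1 ∈ U then k else 0
  else d u

theorem val_burn (d : PathConfig n k) (j : ℕ) (U : Finset ℕ) {u : ℕ}
    (h : u < n * (k - 1) + 1) (h0 : u ≠ 0) : val (burn d j U) u =
      if u = j * (k - 1) then val d u - (k - 1) + U.card else
      if j * (k - 1) ≤ u ∧ u ≤ (j + 1) * (k - 1) then
        val d u + 1 + U.card - if u - j * (k - 1) - 1 ∈ U then k else 0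
      else val d u := by
  simp only [val_of_lt _ h h0, burn]

theorem val_burn_of_lt (d : PathConfig n k) (j : ℕ) (U : Finset ℕ) {u : ℕ}
    (hu : (j + 1) * (k - 1) < u) : val (burn d j U) u = val d u := by
  by_cases h : u < n * (k - 1) + 1
  · rw [val_burn d j U h (by omega)]
    rw [Nat.succ_mul] at hu ⊢
    rw [if_neg (by omega), if_neg (by omega)]
  · unfold val
    rw [dif_neg fun e => h e.1, dif_neg fun e => h e.1]

theorem val_burn_pos (d : PathConfig n k) {j i : ℕ} (U : Finset ℕ) (hj : j < n)
    (hi : i < k - 1) : val (burn d j U) (j * (k - 1) + i + 1) =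
      val d (j * (k - 1) + i + 1) + 1 + U.card - if i ∈ U then k else 0 := by
  rw [val_burn d j U (pos_lt hj hi) (Nat.succ_ne_zero _), if_neg (by omega), if_pos]
  · have : j * (k - 1) + i + 1 - j * (k - 1) - 1 = i := by omega
    rw [this]
  · rw [Nat.succ_mul]; omega

theorem eq_burn_empty_of_arrow {c₀ d d' : PathConfig n k} {j : ℕ} {v : PathVertex n k}
    (hv : v.1 = j * (k - 1)) (h : Arrow (pathEdges n k) k 0 c₀ d v (pathEdge n k (j + 1)) d') :
    d' = burn d j ∅ := by
  obtain ⟨-, -, ⟨-, rfl, rfl⟩ | ⟨hv0, hg, rfl⟩⟩ := h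
  · refine config_ext fun u hu hu0 => ?_
    have : u ≠ j * (k - 1) := fun e => hu0 (e.trans hv.symm)
    rw [val_bankFire _ _ hu hu0, val_burn _ _ _ hu hu0, if_neg this]
    simp
  · refine config_ext fun u hu hu0 => ?_
    rw [val_fireOn _ _ _ hu hu0, val_burn _ _ _ hu hu0, hv]
    simp

/-- When all vertices of the edge have fired, each has lost `k - 1` dollars and received `k - 1`.
The hypothesis `hd` excludes truncation at the first vertex. -/
theorem burn_range {d : PathConfig n k} {j : ℕ} (hk : 1 ≤ k)
    (hd : j ≠ 0 → k - 1 ≤ val d (j * (k - 1))) : burn d j (range (k - 1)) = d := by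
  refine config_ext fun u hu hu0 => ?_
  rw [val_burn _ _ _ hu hu0, card_range, Nat.succ_mul]
  split_ifs with h1 h2 h3
  · subst h1
    have := hd (by rintro rfl; simp at hu0)
    omega
  · omega
  · rw [mem_range] at h3; omega
  · rfl

theorem fireOn_burn {d : PathConfig n k} {j i : ℕ} {U : Finset ℕ} (hk : 2 ≤ k)
    (hU : ∀ i ∈ U, k ≤ val d (j * (k - 1) + i + 1) + 1 + U.card) (hiU : i ∉ U)
    {v : {u : PathVertex n k // u ≠ 0}} (hv : v.1.1 = j * (k - 1) + i + 1) (hi : i < k - 1) :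
    fireOn k (burn d j U) v (pathEdge n k (j + 1)) = burn d j (insert i U) := by
  refine config_ext fun u hu hu0 => ?_
  rw [val_fireOn _ _ _ hu hu0, val_burn _ _ _ hu hu0, val_burn _ _ _ hu hu0, hv,
    card_insert_of_notMem hiU, Nat.succ_mul]
  by_cases h1 : u = j * (k - 1)
  · have h2 : u ≠ j * (k - 1) + i + 1 := by omega
    rw [if_neg h2, if_pos (by omega), if_pos h1, if_pos h1]
    rfl
  rw [if_neg h1, if_neg h1]
  by_cases h2 : j * (k - 1) ≤ u ∧ u ≤ j * (k - 1) + (k - 1)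
  · obtain ⟨i', rfl⟩ : ∃ i', u = j * (k - 1) + i' + 1 := ⟨u - j * (k - 1) - 1, by omega⟩
    have h3 : j * (k - 1) + i' + 1 - j * (k - 1) - 1 = i' := by omega
    simp only [if_pos h2, h3, mem_insert]
    by_cases h4 : i' = i
    · subst h4
      simp only [if_true, true_or, if_neg hiU]
      omega
    · rw [if_neg (by omega)]
      by_cases h5 : i' ∈ U
      · have := hU i' h5
        simp only [h4, h5, or_true, if_true]
        omega
      · simp only [h4, h5, or_false, if_false]
        omega
  · rw [if_neg h2, if_neg h2, if_neg h2, if_neg (by omega)]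

/-- Criticality makes some unfired vertex of the edge unstable. The greatest unstable vertex cannot
lie beyond the edge, where `d` is stable and unchanged, nor in `U`, since a vertex that has fired
holds too few dollars. Hence the firing graph itself prescribes burning this edge. -/
theorem exists_isGreatest_burn {d : PathConfig n k} {j : ℕ} {U : Finset ℕ} (hk : 2 ≤ k)
    (hj : j < n) (hd : ∀ u, j * (k - 1) < u → val d u < k - 1)
    (hcrit : NoForbidden (range (k - 1)) fun i => val d (j * (k - 1) + i + 1))
    (hU : U ⊆ range (k - 1)) (hne : U ≠ range (k - 1)) :
    ∃ v i, i < k - 1 ∧ i ∉ U ∧ v.1.1 = j * (k - 1) + i + 1 ∧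
      IsGreatest {u : {u : PathVertex n k // u ≠ 0} | k - 1 ≤ burn d j U u} v := by
  have hcard : U.card + (range (k - 1) \ U).card = k - 1 := by
    have := card_sdiff_add_card_eq_card hU
    rw [card_range] at this
    omega
  obtain ⟨i, hi, hle⟩ := hcrit (range (k - 1) \ U) sdiff_subset (by
    rw [sdiff_nonempty]
    exact fun h => hne (hU.antisymm h))
  rw [mem_sdiff, mem_range] at hi
  have hle' : (range (k - 1) \ U).card ≤ val d (j * (k - 1) + i + 1) + 1 := hle
  let v₀ : {u : PathVertex n k // u ≠ 0} :=
    ⟨⟨j * (k - 1) + i + 1, pos_lt hj hi.1⟩, fun e => by simpa using congrArg Fin.val e⟩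
  have hv₀ : k - 1 ≤ burn d j U v₀ := by
    rw [← val_coe (burn d j U)]
    change k - 1 ≤ val (burn d j U) (j * (k - 1) + i + 1)
    rw [val_burn_pos d U hj hi.1, if_neg hi.2]
    omega
  obtain ⟨v, hv⟩ := exists_isGreatest_of_not_stable (k := k) (w := (0 : PathVertex n k))
    (c := burn d j U) fun h => absurd (h v₀) (not_lt.2 hv₀)
  have h1 : v₀.1.1 ≤ v.1.1 := hv.2 hv₀
  have h2 : j * (k - 1) + i + 1 ≤ v.1.1 := h1
  have hv1 : k - 1 ≤ val (burn d j U) v.1.1 := by rw [val_coe]; exact hv.1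
  have h3 : v.1.1 ≤ (j + 1) * (k - 1) := by
    by_contra h
    rw [val_burn_of_lt d j U (not_le.1 h)] at hv1
    have := hd v.1.1 (by omega)
    omega
  rw [Nat.succ_mul] at h3
  obtain ⟨i', hi'⟩ : ∃ i', v.1.1 = j * (k - 1) + i' + 1 := ⟨v.1.1 - j * (k - 1) - 1, by omega⟩
  have hik : i' < k - 1 := by omega
  refine ⟨v, i', hik, fun hmem => ?_, hi', hv⟩
  rw [hi', val_burn_pos d U hj hik, if_pos hmem] at hv1
  have := hd (j * (k - 1) + i' + 1) (by omega)
  omega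

end Edges

/-! ### The triangular identity for a transcendental parameter. -/

section Identity

variable {F K : Type} [Field F] [Field K] [Algebra F K]

/-- `tailCoeff k lam r` is `g^{r-1}(1)`. -/
def tailCoeff (k : ℕ) (lam : K) : ℕ → K
  | 0 => 0
  | r + 1 => 1 / (1 - tailCoeff k lam r / lam ^ k)

/-- The definition inserts `g` innermost, whereas passing to a further edge applies it outermost. -/
theorem gNat_add_two (k : ℕ) (lam : K) (r : ℕ) (x : K) :
    gNat k lam (r + 2) x = 1 / (1 - gNat k lam (r + 1) x / lam ^ k) := by
  induction r generalizing x with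
  | zero => rfl
  | succ r ih => rw [gNat, ih, gNat]

theorem gNat_one_eq (k : ℕ) (lam : K) (r : ℕ) : gNat k lam r 1 = tailCoeff k lam (r + 1) := by
  induction r with
  | zero => simp [gNat, tailCoeff]
  | succ r ih =>
    rw [tailCoeff, ← ih]
    rcases r with _ | r
    · rfl
    · exact gNat_add_two k lam r 1

theorem gFun_one_eq (k : ℕ) (lam : K) (s : ℕ) :
    gFun k lam ((s : ℤ) - 1) 1 = tailCoeff k lam s := by
  rcases s with _ | s
  · simp [gFun, tailCoeff]
  · have h1 : ¬ ((s + 1 : ℕ) : ℤ) - 1 < 0 := by omega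
    have h2 : (((s + 1 : ℕ) : ℤ) - 1).toNat = s := by omega
    rw [gFun, if_neg h1, h2, gNat_one_eq]

variable {n k s : ℕ}

/-- The span of the monomials of the stable configurations of `𝒢'`. -/
noncomputable def stableSpan (n k s : ℕ) (lam : K) (c₀ : PathConfig n k) : Submodule K (PathAlg n k lam) :=
  Submodule.span K (pathMono lam '' {c' | c' ∈ pathG' n k s c₀ ∧ Stable k c'})

theorem pathMono_mem_stableSpan (hk : 1 ≤ k) {lam : K} (hlam : Transcendental F lam)
    {c₀ c : PathConfig n k} (hc : c ∈ pathG' n k s c₀) :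
    pathMono lam c ∈ stableSpan n k s lam c₀ :=
  mono_mem_span_stable (pathEdges n k) k 0 lam hlam
    ((finite_firingVertices hk c₀).subset (pathG'_subset_firingVertices c₀))
    (fun _ hc _ hv _ he hve => fireOn_mem_pathG' hc hv he hve) hc

/-- Firing the first vertex of a critical edge replaces the monomial of `d` by a multiple of it,
modulo the monomials of the stable configurations of `𝒢'`. -/
theorem pathMono_fire_sub_mem (hk : 2 ≤ k) (hs : s ≤ n) {lam : K} (hlam : Transcendental F lam)
    (hne : ∀ r, 1 - tailCoeff k lam r / lam ^ k ≠ 0)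
    {c₀ : PathConfig n k} (hc₀ : c₀ ∈ pathB n k s) (r j : ℕ) (hjr : j + r = s) (hj : j < n)
    (d : PathConfig n k) (hreach : Reach (pathEdges n k) k 0 c₀ c₀ d)
    (hd : ∀ u, j * (k - 1) < u → val d u = val c₀ u) (v : PathVertex n k) (d' : PathConfig n k)
    (hv : v.1 = j * (k - 1))
    (harr : Arrow (pathEdges n k) k 0 c₀ d v (pathEdge n k (j + 1)) d') :
    pathMono lam d' - (tailCoeff k lam r / lam ^ (k - 1)) • pathMono lam d ∈
      stableSpan n k s lam c₀ := by
  have hlam0 : lam ≠ 0 := by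
    rintro rfl
    exact hlam isAlgebraic_zero
  -- Here `r` counts the critical edges from edge number `j` on. At `r = 0` the arrow is the one
  -- defining `𝒢'`, so `d'` itself contributes only to the span.
  induction r generalizing j d v d' with
  | zero =>
    obtain rfl : j = s := by omega
    simp only [tailCoeff, zero_div, zero_smul, sub_zero]
    have hv' : v = Fin.ofNat (n * (k - 1) + 1) (j * (k - 1)) := by
      apply Fin.ext
      rw [hv, Fin.val_ofNat, Nat.mod_eq_of_lt]
      exact Nat.lt_succ_of_le (Nat.mul_le_mul_right _ hj.le)
    refine pathMono_mem_stableSpan (by omega) hlam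
      ⟨hj, d, hreach, d', ?_, Relation.ReflTransGen.refl⟩
    rw [← hv']
    exact harr
  | succ r ih =>
    have hfull : j ≠ 0 → k - 1 ≤ val d (j * (k - 1)) := by
      intro hj0
      obtain ⟨-, -, ⟨-, rfl, -⟩ | ⟨hv0, hg, -⟩⟩ := harr
      · exact absurd hv.symm (Nat.mul_ne_zero hj0 (by omega))
      · have : k - 1 ≤ d ⟨v, hv0⟩ := hg.1
        rw [← val_coe d] at this
        rwa [← hv]
    have hdlt : ∀ u, j * (k - 1) < u → val d u < k - 1 := fun u hu => by
      rw [hd u hu]; exact val_lt_of_stable hk hc₀.1 u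
    have hcrit : NoForbidden (range (k - 1)) fun i => val d (j * (k - 1) + i + 1) := by
      have h1 := noForbidden_of_mem_pathB hc₀ (t := j) (by omega) hj
      have h2 : (fun i => val d (j * (k - 1) + i + 1)) =
          fun i => val c₀ (j * (k - 1) + i + 1) := by
        funext i
        exact hd _ (by omega)
      rwa [h2]
    -- `N` is the number of firings left before the configuration returns to `d`. Each costs
    -- `lam⁻¹`, and the joint, with index `k - 2`, contributes the extra factor `tailCoeff (r + 1)`
    -- as long as it has not fired.
    have key : ∀ N U, U.card + N = k - 1 → U ⊆ range (k - 1) →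
        (∀ i ∈ U, k ≤ val d (j * (k - 1) + i + 1) + 1 + U.card) →
        Reach (pathEdges n k) k 0 c₀ c₀ (burn d j U) →
        pathMono lam (burn d j U) -
          ((lam ^ N)⁻¹ * if k - 2 ∈ U then 1 else tailCoeff k lam (r + 1)) • pathMono lam d ∈
            stableSpan n k s lam c₀ := by
      intro N
      induction N with
      | zero =>
        intro U hUN hU _ _
        have hU' : U = range (k - 1) := eq_of_subset_of_card_le hU (by rw [card_range]; omega)
        rw [hU', burn_range (by omega) hfull, if_pos (mem_range.2 (by omega))]
        simp
      | succ N ihN =>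
        intro U hUN hU hgood hr
        obtain ⟨x, i, hi, hiU, hx, hg⟩ := exists_isGreatest_burn hk hj hdlt hcrit hU
          (by rintro rfl; rw [card_range] at hUN; omega)
        have hfire := fireOn_burn hk hgood hiU hx hi
        have hxe : x.1 ∈ pathEdge n k (j + 1) := (mem_pathEdge_pos hi hx).2 (Or.inl rfl)
        have harr' : ∀ t, x.1 ∈ pathEdge n k (t + 1) → t < n →
            Arrow (pathEdges n k) k 0 c₀ (burn d j U) x.1 (pathEdge n k (t + 1))
              (fireOn k (burn d j U) x (pathEdge n k (t + 1))) := fun t ht htn =>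
          ⟨pathEdge_mem_pathEdges htn, ht, Or.inr ⟨x.2, hg, rfl⟩⟩
        have hins : (insert i U).card = U.card + 1 := card_insert_of_notMem hiU
        have hxval : k - 1 ≤ val (burn d j U) (j * (k - 1) + i + 1) := by
          rw [← hx, val_coe]; exact hg.1
        rw [val_burn_pos d U hj hi, if_neg hiU] at hxval
        have h1 := ihN (insert i U) (by omega)
          (insert_subset (mem_range.2 hi) hU) (by
            intro i' hi'
            rw [hins]
            rcases mem_insert.1 hi' with rfl | hi'
            · omega
            · have := hgood i' hi'; omega)
          (by rw [← hfire]; exact hr.tail ⟨_, _, harr' j hxe hj⟩)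
        have hrel := smul_mono (pathEdges n k) k 0 lam (burn d j U) x hg.1
        -- Away from the joint only one edge is available and the relation is exact. At the joint,
        -- the branch into the next edge is by induction a multiple of the same monomial and moves
        -- to the left-hand side.
        have h2 : (lam - if i = k - 2 then tailCoeff k lam r / lam ^ (k - 1) else 0) •
            pathMono lam (burn d j U) - pathMono lam (burn d j (insert i U)) ∈
            stableSpan n k s lam c₀ := by
          by_cases hik : i = k - 2
          · rcases Nat.lt_or_ge (j + 1) n with hjn | hjn
            · rw [filter_pathEdges_joint hjn (by omega) hx,
                sum_pair (pathEdge_ne_succ hj hk), hfire] at hrel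
              rw [if_pos hik, sub_smul, hrel]
              have h3 := ih (j + 1) (by omega) hjn (burn d j U) hr (fun u hu => by
                  rw [val_burn_of_lt d j U hu]
                  rw [Nat.succ_mul] at hu
                  exact hd u (by omega)) x.1 _ (by rw [hx, Nat.succ_mul]; omega)
                (harr' (j + 1) ((mem_pathEdge_pos hi hx).2 (Or.inr ⟨rfl, by omega⟩)) hjn)
              convert h3 using 1
              abel
            -- On the last edge there is no second branch; `s ≤ n` forces `r = 0`, and `tailCoeff 0
            -- = 0` agrees with this.
            · obtain rfl : r = 0 := by omega
              rw [filter_pathEdges_left hj hi hx (by omega), sum_singleton, hfire] at hrel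
              rw [if_pos hik, tailCoeff, zero_div, sub_zero, hrel, sub_self]
              exact Submodule.zero_mem _
          · rw [filter_pathEdges_left hj hi hx (by omega), sum_singleton, hfire] at hrel
            rw [if_neg hik, sub_zero, hrel, sub_self]
            exact Submodule.zero_mem _
        set ε := if i = k - 2 then tailCoeff k lam r / lam ^ (k - 1) else 0 with hε
        have hlk : lam - tailCoeff k lam r / lam ^ (k - 1) =
            lam * (1 - tailCoeff k lam r / lam ^ k) := by
          have : lam ^ k = lam ^ (k - 1) * lam := by
            rw [← pow_succ]; congr 1; omega
          rw [this]
          field_simp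
        have hεne : lam - ε ≠ 0 := by
          rw [hε]
          split_ifs
          · rw [hlk]; exact mul_ne_zero hlam0 (hne r)
          · rwa [sub_zero]
        have hcoef : (lam ^ N)⁻¹ * (if k - 2 ∈ insert i U then 1 else tailCoeff k lam (r + 1)) =
            (lam - ε) *
              ((lam ^ (N + 1))⁻¹ * if k - 2 ∈ U then 1 else tailCoeff k lam (r + 1)) := by
          by_cases hik : i = k - 2
          · subst hik
            have hnr := hne r
            rw [hε, if_pos rfl, hlk, if_pos (mem_insert_self _ _), if_neg hiU, tailCoeff,
              pow_succ]
            generalize 1 - tailCoeff k lam r / lam ^ k = q at hnr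
            field_simp
          · have h4 : k - 2 ∈ insert i U ↔ k - 2 ∈ U := by
              rw [mem_insert]
              exact or_iff_right fun e => hik e.symm
            rw [hε, if_neg hik, sub_zero, pow_succ]
            simp only [h4]
            field_simp
        -- Both terms now carry the factor `lam - ε`, which is nonzero and can be cancelled.
        have h5 := Submodule.add_mem _ h2 h1
        rw [hcoef, mul_smul, sub_add_sub_cancel, ← smul_sub] at h5
        exact (Submodule.smul_mem_iff _ hεne).1 h5
    have h0 := key (k - 1) ∅ (by simp) (empty_subset _) (by simp)
      (by rw [← eq_burn_empty_of_arrow hv harr]; exact hreach.tail ⟨_, _, harr⟩)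
    rw [← eq_burn_empty_of_arrow hv harr, if_neg (notMem_empty _)] at h0
    rwa [div_eq_inv_mul]

theorem pathMono_bankFire_sub_mem (hn : 1 ≤ n) (hk : 2 ≤ k) (hs : s ≤ n) {lam : K}
    (hlam : Transcendental F lam) (hne : ∀ r, 1 - tailCoeff k lam r / lam ^ k ≠ 0)
    {c₀ : PathConfig n k} (hc₀ : c₀ ∈ pathB n k s) :
    pathMono lam (bankFire c₀ (pathEdge n k 1)) -
      (tailCoeff k lam s / lam ^ (k - 1)) • pathMono lam c₀ ∈ stableSpan n k s lam c₀ :=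
  pathMono_fire_sub_mem hk hs hlam hne hc₀ s 0 (zero_add s) hn c₀ Relation.ReflTransGen.refl
    (fun _ _ => rfl) 0 _ (by simp)
    ⟨pathEdge_mem_pathEdges hn, mem_pathEdge.2 (by simp), Or.inl ⟨rfl, rfl, rfl⟩⟩

theorem pathF0_mul (hn : 1 ≤ n) (hk : 2 ≤ k) (lam : K) (c : PathConfig n k) :
    pathF0 n k lam * pathMono lam c =
      lam • pathMono lam c - pathMono lam (bankFire c (pathEdge n k 1)) := by
  have := bankF_mul_mono (pathEdges n k) k 0 lam c
  rwa [filter_pathEdges_zero hn hk, sum_singleton] at this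

end Identity

end Hyperpath

namespace Hyperpath

open MvPolynomial Finset Filter

/-! ### Specialization from `ℂ(λ)` to almost all complex numbers. -/

section Transfer

/-- At infinity every `tailCoeff` has valuation at most 1, while `X^k` has valuation greater than 1.
The subtracted term is therefore small and the difference has valuation exactly 1. -/
theorem tailCoeff_ratFunc_ne (k : ℕ) (hk : 1 ≤ k) (r : ℕ) :
    1 - tailCoeff k (RatFunc.X : RatFunc ℂ) r / RatFunc.X ^ k ≠ 0 := by
  classical
  have hX : (1 : WithZero (Multiplicative ℤ)) < RatFunc.inftyValuation ℂ RatFunc.X ^ k := by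
    refine one_lt_pow₀ ?_ (by omega)
    rw [RatFunc.inftyValuation.X, ← WithZero.exp_zero]
    exact WithZero.exp_lt_exp.2 one_pos
  have hlt : ∀ x : RatFunc ℂ, RatFunc.inftyValuation ℂ x ≤ 1 →
      RatFunc.inftyValuation ℂ (1 - x / RatFunc.X ^ k) = 1 := fun x hx => by
    refine Valuation.map_one_sub_of_lt _ ?_
    rw [map_div₀, map_pow]
    exact (div_lt_one₀ (zero_lt_one.trans hX)).2 (hx.trans_lt hX)
  have hle : RatFunc.inftyValuation ℂ (tailCoeff k (RatFunc.X : RatFunc ℂ) r) ≤ 1 := by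
    induction r with
    | zero => simp [tailCoeff]
    | succ r ih => rw [tailCoeff, map_div₀, hlt _ ih, map_one, div_one]
  intro h
  have := hlt _ hle
  rw [h, map_zero] at this
  exact zero_ne_one this

theorem eventually_denom_ne_zero (f : RatFunc ℂ) :
    ∀ᶠ lam : ℂ in cofinite, Polynomial.eval₂ (RingHom.id ℂ) lam f.denom ≠ 0 := by
  refine (Polynomial.finite_setOfPred_isRoot (RatFunc.denom_ne_zero f)).subset fun lam h => ?_
  simpa [Polynomial.IsRoot, Polynomial.eval₂_id] using h

/-- A rational function as a germ of functions along the cofinite filter. -/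
noncomputable def ratFuncGerm : RatFunc ℂ →+* Germ (cofinite : Filter ℂ) ℂ where
  toFun f := ((fun lam => RatFunc.eval (RingHom.id ℂ) lam f : ℂ → ℂ) : Germ cofinite ℂ)
  map_zero' := Germ.coe_eq.2 (Eventually.of_forall fun lam => RatFunc.eval_zero _ _)
  map_one' := Germ.coe_eq.2 (Eventually.of_forall fun lam => RatFunc.eval_one _ _)
  map_add' f g := Germ.coe_eq.2 (by
    filter_upwards [eventually_denom_ne_zero f, eventually_denom_ne_zero g] with lam hf hg
    exact RatFunc.eval_add _ _ hf hg)
  map_mul' f g := Germ.coe_eq.2 (by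
    filter_upwards [eventually_denom_ne_zero f, eventually_denom_ne_zero g] with lam hf hg
    exact RatFunc.eval_mul _ _ hf hg)

theorem ratFuncGerm_apply (f : RatFunc ℂ) : ratFuncGerm f =
    ((fun lam => RatFunc.eval (RingHom.id ℂ) lam f : ℂ → ℂ) : Germ cofinite ℂ) := rfl

theorem ratFuncGerm_X : ratFuncGerm RatFunc.X = ((fun lam => lam : ℂ → ℂ) : Germ cofinite ℂ) := by
  rw [ratFuncGerm_apply]
  congr 1
  funext lam
  exact RatFunc.eval_X ..

theorem eventually_ne_zero : ∀ᶠ lam : ℂ in cofinite, lam ≠ 0 :=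
  (Set.finite_singleton (0 : ℂ)).subset fun _ h => not_not.1 h

theorem eventually_eval_div_X_pow (f : RatFunc ℂ) (i : ℕ) : ∀ᶠ lam : ℂ in cofinite,
    RatFunc.eval (RingHom.id ℂ) lam (f / RatFunc.X ^ i) =
      RatFunc.eval (RingHom.id ℂ) lam f / lam ^ i := by
  have h : f / RatFunc.X ^ i * RatFunc.X ^ i = f :=
    div_mul_cancel₀ _ (pow_ne_zero _ RatFunc.X_ne_zero)
  have h1 := congrArg ratFuncGerm h
  rw [map_mul, map_pow, ratFuncGerm_X, ratFuncGerm_apply, ratFuncGerm_apply, ← Germ.coe_pow,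
    ← Germ.coe_mul, Germ.coe_eq] at h1
  filter_upwards [h1, eventually_ne_zero] with lam h2 h3
  rw [eq_div_iff (pow_ne_zero _ h3)]
  exact h2

theorem eventually_eval_tailCoeff (k : ℕ) (hk : 1 ≤ k) (r : ℕ) : ∀ᶠ lam : ℂ in cofinite,
    RatFunc.eval (RingHom.id ℂ) lam (tailCoeff k RatFunc.X r) = tailCoeff k lam r := by
  induction r with
  | zero => exact Eventually.of_forall fun lam => by simp [tailCoeff]
  | succ r ih =>
    have h1 : (1 - tailCoeff k RatFunc.X r / RatFunc.X ^ k : RatFunc ℂ) *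
        tailCoeff k RatFunc.X (r + 1) = 1 := mul_one_div_cancel (tailCoeff_ratFunc_ne k hk r)
    have h2 := congrArg ratFuncGerm h1
    rw [map_mul, map_sub, map_one, ratFuncGerm_apply, ratFuncGerm_apply, ← Germ.coe_one,
      ← Germ.coe_sub, ← Germ.coe_mul, Germ.coe_eq] at h2
    filter_upwards [h2, ih, eventually_eval_div_X_pow (tailCoeff k RatFunc.X r) k]
      with lam h3 h4 h5
    simp only [Pi.mul_apply, Pi.sub_apply, Pi.one_apply] at h3
    rw [h5, h4] at h3
    rw [tailCoeff]
    exact eq_one_div_of_mul_eq_one_right h3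

variable {σ : Type*}

/-- A polynomial over `ℂ(λ)` as a germ, along the cofinite filter, of functions with values in the
polynomials over `ℂ`. -/
noncomputable def polyGerm (σ : Type*) :
    MvPolynomial σ (RatFunc ℂ) →+* Germ (cofinite : Filter ℂ) (MvPolynomial σ ℂ) :=
  eval₂Hom
    { toFun := fun f => Germ.map C (ratFuncGerm f)
      map_zero' := by rw [map_zero]; exact congrArg _ (_root_.funext fun _ => C_0)
      map_one' := by rw [map_one]; exact congrArg _ (_root_.funext fun _ => C_1)
      map_add' := fun f g => by
        rw [map_add]
        exact congrArg _ (_root_.funext fun _ => C_add)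
      map_mul' := fun f g => by
        rw [map_mul]
        exact congrArg _ (_root_.funext fun _ => C_mul) }
    fun i => Germ.coeRingHom cofinite fun _ => X i

theorem polyGerm_C (f : RatFunc ℂ) : polyGerm σ (C f) =
    Germ.coeRingHom cofinite fun lam => C (RatFunc.eval (RingHom.id ℂ) lam f) :=
  eval₂Hom_C _ _ _

theorem polyGerm_X (i : σ) : polyGerm σ (X i) = Germ.coeRingHom cofinite fun _ => X i :=
  eval₂Hom_X' _ _ _

theorem polyGerm_prod_X_pow [Fintype σ] (c : σ → ℕ) : polyGerm σ (∏ u, X u ^ c u) =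
    Germ.coeRingHom cofinite fun _ => ∏ u, X u ^ c u := by
  have : (fun _ : ℂ => ∏ u, (X u : MvPolynomial σ ℂ) ^ c u) = ∏ u, (fun _ => X u) ^ c u := by
    funext lam; simp
  rw [this, map_prod, map_prod]
  simp only [map_pow, polyGerm_X]

variable {V : Type*} [DecidableEq V] [Fintype V] (E : Finset (Finset V)) (k : ℕ) (w : V)

theorem polyGerm_smallF (v : V) :
    polyGerm {u : V // u ≠ w} (smallF E k w (RatFunc.X : RatFunc ℂ) v) =
      Germ.coeRingHom cofinite fun lam => smallF E k w lam v := by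
  have h : (fun lam : ℂ => smallF E k w lam v) =
      (fun lam => C lam) * (fun _ => if h : v = w then 1 else X ⟨v, h⟩) ^ (k - 1) -
        ∑ e ∈ E with v ∈ e, fun _ => ∏ u : {u : V // u ≠ w}, X u ^
          (if u.1 ∈ e.erase v then 1 else 0) := by
    funext lam
    rw [smallF_eq]
    simp
  rw [h, smallF_eq]
  simp only [map_sub, map_mul, map_pow, map_sum, polyGerm_prod_X_pow, polyGerm_C, RatFunc.eval_X]
  split_ifs with h
  · simp only [map_one]
    rw [show (fun _ : ℂ => (1 : MvPolynomial {u : V // u ≠ w} ℂ)) = 1 from rfl, map_one]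
  · rw [polyGerm_X]

/-- Membership in the ideal of the hypergraph over `ℂ(λ)` specializes to all but finitely many
complex numbers. -/
theorem eventually_mem_pIdeal {P : MvPolynomial {u : V // u ≠ w} (RatFunc ℂ)}
    (hP : P ∈ pIdeal E k w RatFunc.X) {Q : ℂ → MvPolynomial {u : V // u ≠ w} ℂ}
    (hQ : polyGerm _ P = Germ.coeRingHom cofinite Q) :
    ∀ᶠ lam in cofinite, Q lam ∈ pIdeal E k w lam := by
  -- Two representatives of a germ agree at all but finitely many points, so any one of them may be
  -- used, and the induction can choose a convenient one.
  suffices ∃ Q, polyGerm _ P = Germ.coeRingHom cofinite Q ∧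
      ∀ᶠ lam in cofinite, Q lam ∈ pIdeal E k w lam by
    obtain ⟨Q', hQ', h⟩ := this
    have h2 := Germ.coe_eq.1 (hQ.symm.trans hQ')
    filter_upwards [h, h2] with lam h3 h4
    rwa [h4]
  clear hQ
  induction hP using Submodule.span_induction with
  | mem x hx =>
    obtain ⟨v, rfl⟩ := hx
    exact ⟨_, polyGerm_smallF E k w v.1,
      Eventually.of_forall fun lam => Ideal.subset_span ⟨v, rfl⟩⟩
  | zero => exact ⟨0, by rw [map_zero, map_zero], Eventually.of_forall fun lam => Ideal.zero_mem _⟩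
  | add x y _ _ hx hy =>
    obtain ⟨Q₁, h1, h1'⟩ := hx
    obtain ⟨Q₂, h2, h2'⟩ := hy
    refine ⟨Q₁ + Q₂, by rw [map_add, map_add, h1, h2], ?_⟩
    filter_upwards [h1', h2'] with lam h3 h4
    exact Ideal.add_mem _ h3 h4
  | smul a x _ hx =>
    obtain ⟨Q₁, h1, h1'⟩ := hx
    obtain ⟨A, hA⟩ : ∃ A : ℂ → MvPolynomial {u : V // u ≠ w} ℂ,
        polyGerm _ a = Germ.coeRingHom cofinite A :=
      (polyGerm _ a).inductionOn fun A => ⟨A, rfl⟩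
    refine ⟨A * Q₁, by rw [smul_eq_mul, map_mul, map_mul, h1, hA], ?_⟩
    filter_upwards [h1'] with lam h3
    exact Ideal.mul_mem_left _ _ h3

theorem eventually_mono_eq {c c₁ : Config w} {S : Finset (Config w)} {g : RatFunc ℂ}
    {h : Config w → RatFunc ℂ}
    (heq : mono E k w (RatFunc.X : RatFunc ℂ) c = g • mono E k w RatFunc.X c₁ +
      ∑ c' ∈ S, h c' • mono E k w RatFunc.X c') :
    ∀ᶠ lam : ℂ in cofinite, mono E k w lam c =
      RatFunc.eval (RingHom.id ℂ) lam g • mono E k w lam c₁ +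
        ∑ c' ∈ S, RatFunc.eval (RingHom.id ℂ) lam (h c') • mono E k w lam c' := by
  have hmk : ∀ {K : Type} [Field K] (lam a : K) (c : Config w), a • mono E k w lam c =
      Ideal.Quotient.mk (pIdeal E k w lam) (C a * ∏ u, X u ^ c u) := by
    intro K _ lam a c
    rw [← smul_eq_C_mul]
    rfl
  simp only [hmk] at heq ⊢
  simp only [mono, ← map_sum, ← map_add, Ideal.Quotient.eq] at heq ⊢
  refine eventually_mem_pIdeal E k w heq ?_
  have hfun : (fun lam : ℂ => ∏ u, X u ^ c u -
      (C (RatFunc.eval (RingHom.id ℂ) lam g) * ∏ u, X u ^ c₁ u +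
        ∑ c' ∈ S, C (RatFunc.eval (RingHom.id ℂ) lam (h c')) * ∏ u, X u ^ c' u)) =
      (fun _ => ∏ u, (X u : MvPolynomial {u : V // u ≠ w} ℂ) ^ c u) -
        ((fun lam => C (RatFunc.eval (RingHom.id ℂ) lam g)) * (fun _ => ∏ u, X u ^ c₁ u) +
          ∑ c' ∈ S, (fun lam => C (RatFunc.eval (RingHom.id ℂ) lam (h c'))) *
            fun _ => ∏ u, X u ^ c' u) := by
    funext lam
    simp
  rw [hfun]
  simp only [map_sub, map_add, map_mul, map_sum, polyGerm_prod_X_pow, polyGerm_C]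

end Transfer

end Hyperpath

open Hyperpath
theorem lemma4p3 (n k s : ℕ) (hn : 1 ≤ n) (hk : 2 ≤ k) (hs : s ≤ n)
    (c₀ : PathConfig n k) (hc₀ : c₀ ∈ pathB n k s) :
    (∀ c' ∈ stableG' n k s c₀, Prec c₀ c') ∧
    ∃ h : PathConfig n k → RatFunc ℂ,
      (pathMono (RatFunc.X : RatFunc ℂ) (bankFire c₀ (pathEdge n k 1)) =
          (gFun k (RatFunc.X : RatFunc ℂ) ((s : ℤ) - 1) 1 / RatFunc.X ^ (k - 1)) •
              pathMono (RatFunc.X : RatFunc ℂ) c₀ +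
            ∑ c' ∈ stableG' n k s c₀, h c' • pathMono (RatFunc.X : RatFunc ℂ) c' ∧
        pathF0 n k (RatFunc.X : RatFunc ℂ) * pathMono (RatFunc.X : RatFunc ℂ) c₀ =
          (RatFunc.X - gFun k (RatFunc.X : RatFunc ℂ) ((s : ℤ) - 1) 1 / RatFunc.X ^ (k - 1)) •
              pathMono (RatFunc.X : RatFunc ℂ) c₀ -
            ∑ c' ∈ stableG' n k s c₀, h c' • pathMono (RatFunc.X : RatFunc ℂ) c') ∧
      (∀ᶠ lam : ℂ in Filter.cofinite,
        pathMono lam (bankFire c₀ (pathEdge n k 1)) =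
          (gFun k lam ((s : ℤ) - 1) 1 / lam ^ (k - 1)) • pathMono lam c₀ +
            ∑ c' ∈ stableG' n k s c₀,
              RatFunc.eval (RingHom.id ℂ) lam (h c') • pathMono lam c' ∧
        pathF0 n k lam * pathMono lam c₀ =
          (lam - gFun k lam ((s : ℤ) - 1) 1 / lam ^ (k - 1)) • pathMono lam c₀ -
            ∑ c' ∈ stableG' n k s c₀,
              RatFunc.eval (RingHom.id ℂ) lam (h c') • pathMono lam c') := by
  have hcoe : {c' | c' ∈ pathG' n k s c₀ ∧ Stable k c'} = ↑(stableG' n k s c₀) :=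
    (Set.Finite.coe_toFinset _).symm
  refine ⟨fun c' hc' => prec_of_mem_pathG' hk hc₀ ?_, ?_⟩
  · have : c' ∈ {c' | c' ∈ pathG' n k s c₀ ∧ Stable k c'} := by rw [hcoe]; exact hc'
    exact this.1
  simp only [gFun_one_eq]
  have hmem := pathMono_bankFire_sub_mem hn hk hs (F := ℂ) (lam := RatFunc.X)
    RatFunc.transcendental_X (tailCoeff_ratFunc_ne k (by omega)) hc₀
  -- The coefficients `h` are fixed here, over `ℂ(λ)`; the same functions are evaluated in the
  -- complex case.
  rw [stableSpan, hcoe, Submodule.mem_span_image_finset_iff_exists_fun'] at hmem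
  obtain ⟨h, hh⟩ := hmem
  have hgen := eq_add_of_sub_eq' hh.symm
  refine ⟨h, ⟨hgen, ?_⟩, ?_⟩
  · rw [pathF0_mul hn hk, hgen, sub_smul, sub_sub]
  · filter_upwards [eventually_mono_eq (pathEdges n k) k 0 hgen,
      eventually_eval_div_X_pow (tailCoeff k RatFunc.X s) (k - 1),
      eventually_eval_tailCoeff k (by omega) s] with lam h1 h2 h3
    rw [h2, h3] at h1
    refine ⟨h1, ?_⟩
    rw [pathF0_mul hn hk, sub_smul, sub_sub]
    exact congrArg _ h1
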